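/- Let $\mathsf V$ be the variety of all $\ell$-groups (respectively, of representable $\ell$-groups, i.e. subdirect products of totally ordered groups, or of Abelian $\ell$-groups), and let $G$ be a partially ordered group. Let $\eta\colon G\to F_{\mathsf V}(G)$ be the universal positive homomorphism to the $\ell$-group freely generated by $G$ in $\mathsf V$. A *right pre-order* on a partially ordered group $G$ is given by its positive cone: a proper submonoid $C\subsetneq G$ with $G^+\subseteq C$ and $G=C\cup C^{-1}$ (so $a\preceq_C b\iff ba^{-1}\in C$). Let $\Omega_C$ be the chain of classes $[a]$ of $G$ modulo $a\preceq_C b\preceq_C a$, and let $H_C$ be the $\ell$-subgroup of $\mathrm{Aut}(\Omega_C)$ (with product $f\cdot g$ = "$g$ after $f$" and pointwise lattice operations) generated by the maps $[b]\mapsto[ba]$, $a\in G$. Let $\mathcal P_{\mathsf V}(G)$ be the set of right pre-orders $C$ on $G$ with $H_C\in\mathsf V$, with the smallest topology in which the sets $\mathbb P(a)=\{C : a\in C,\ a^{-1}\notin C\}$, $a\in G$, are open. Its *minimal layer* is the subspace of its inclusion-minimal members. A *right order* is a right pre-order $C$ with $C\cap C^{-1}=\{e\}$, and an *order* is a right order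 whose cone is closed under conjugation; both sets carry the topology induced by the sets $\mathbb P(a)$. The group $\eta[G]$ is partially ordered by the restriction of the order of $F_{\mathsf V}(G)$. For $S$ a subset of an $\ell$-group $H$ let $S^\perp=\{x : |x|\wedge|y|=e \text{ for all } y\in S\}$; the sets $S^\perp$ are the polars of $H$, which form a Boolean algebra under inclusion with complement $T\mapsto T^\perp$, and the *principal polars* are the sets $x^{\perp\perp}=\{x\}^{\perp\perp}$, $x\in H$. **Theorem.** The minimal layer of $\mathcal P_{\mathsf V}(G)$ is a Stone space (compact, Hausdorff, totally disconnected). The set of principal polars of $F_{\mathsf V}(G)$ is a Boolean subalgebra of the algebra of polars of $F_{\mathsf V}(G)$, and it is the dual Boolean algebra of the minimal layer: it is isomorphic to the Boolean algebra of clopen subsets of the minimal layer, and the minimal layer is homeomorphic to its Stone dual, the space of its prime ideals with the topology generated by the sets of prime ideals that omit a given element. Moreover, $C\mapsto\eta[C]$ is a homeomorphism from the minimal layer onto the space of right orders on $\eta[G]$ if $\mathsf V$ is the variety of all $\ell$-groups, and onto the space of orders on $\eta[G]$ if $\mathsf V$ is the variety of representable or of Abelian $\ell$-groups. -/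

import Mathlib

universe u

namespace LGrp

/-! ### Lattice-ordered groups

A partially ordered group is a type with `Group`, `PartialOrder`, `MulLeftMono`, `MulRightMono`;
an `ℓ`-group is a type with `Group`, `Lattice`, `MulLeftMono`, `MulRightMono`. -/

/-- A class of `ℓ`-groups. -/
def LGroupClass : Type (u + 1) :=
  ∀ (H : Type u) [Group H] [Lattice H] [MulLeftMono H] [MulRightMono H], Prop

/-- A group homomorphism between `ℓ`-groups is an `ℓ`-homomorphism if it preserves `⊔` and `⊓`. -/
def IsLHom {H K : Type*} [Group H] [Lattice H] [Group K] [Lattice K] (f : H →* K) : Prop :=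
  (∀ a b, f (a ⊔ b) = f a ⊔ f b) ∧ ∀ a b, f (a ⊓ b) = f a ⊓ f b

/-- The variety of all `ℓ`-groups. -/
def allLGroups : LGroupClass.{u} := fun _ _ _ _ _ => True

/-- The variety of Abelian `ℓ`-groups. -/
def abelianLGroups : LGroupClass.{u} := fun H _ _ _ _ => ∀ a b : H, a * b = b * a

/-- The variety of representable `ℓ`-groups: the subdirect products of totally ordered groups. -/
def representableLGroups : LGroupClass.{u} := fun H _ _ _ _ =>
  ∃ (ι : Type u) (L : ι → Type u) (_ : ∀ i, Group (L i)) (_ : ∀ i, LinearOrder (L i))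
    (_ : ∀ i, MulLeftMono (L i)) (_ : ∀ i, MulRightMono (L i)) (f : ∀ i, H →* L i),
    (∀ i, IsLHom (f i)) ∧ (∀ i, Function.Surjective (f i)) ∧
      ∀ x y : H, (∀ i, f i x = f i y) → x = y

/-! ### The `ℓ`-group generated by a subset -/

section Closure

variable {K : Type*} [Group K] [Lattice K]

/-- The `ℓ`-subgroup (sublattice subgroup) generated by `S`. -/
def lClosure (S : Set K) : Subgroup K :=
  sInf {L : Subgroup K | S ⊆ L ∧ (∀ a ∈ L, ∀ b ∈ L, a ⊔ b ∈ L) ∧ ∀ a ∈ L, ∀ b ∈ L, a ⊓ b ∈ L}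

theorem lClosure_sup (S : Set K) {a b : K} (ha : a ∈ lClosure S) (hb : b ∈ lClosure S) :
    a ⊔ b ∈ lClosure S := by
  simp only [lClosure, Subgroup.mem_sInf] at ha hb ⊢
  exact fun L hL => hL.2.1 _ (ha L hL) _ (hb L hL)

theorem lClosure_inf (S : Set K) {a b : K} (ha : a ∈ lClosure S) (hb : b ∈ lClosure S) :
    a ⊓ b ∈ lClosure S := by
  simp only [lClosure, Subgroup.mem_sInf] at ha hb ⊢
  exact fun L hL => hL.2.2 _ (ha L hL) _ (hb L hL)

instance lClosureLattice (S : Set K) : Lattice (lClosure S) :=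
  Subtype.lattice (fun _ _ ha hb => lClosure_sup S ha hb) (fun _ _ ha hb => lClosure_inf S ha hb)

end Closure

section SubgroupMono

variable {K : Type*} [Group K] [PartialOrder K]

instance subgroupMulLeftMono [MulLeftMono K] (L : Subgroup K) : MulLeftMono L :=
  ⟨fun c _ _ h => mul_le_mul_right (α := K) h (c : K)⟩

instance subgroupMulRightMono [MulRightMono K] (L : Subgroup K) : MulRightMono L :=
  ⟨fun c _ _ h => mul_le_mul_left (α := K) h (c : K)⟩

instance lClosureMulLeftMono {K : Type*} [Group K] [Lattice K] [MulLeftMono K] (S : Set K) :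
    MulLeftMono (lClosure S) :=
  ⟨fun c _ _ h => mul_le_mul_right (α := K) h (c : K)⟩

instance lClosureMulRightMono {K : Type*} [Group K] [Lattice K] [MulRightMono K] (S : Set K) :
    MulRightMono (lClosure S) :=
  ⟨fun c _ _ h => mul_le_mul_left (α := K) h (c : K)⟩

end SubgroupMono

/-! ### The `ℓ`-group of order automorphisms of a chain -/

/-- The `ℓ`-group of order-preserving bijections of a chain `Ω`, where `f * g` is
"`g` after `f`" and the lattice operations are pointwise. -/
def Aut (Ω : Type*) [LinearOrder Ω] : Type _ := Ω ≃o Ω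

namespace Aut

variable {Ω : Type*} [LinearOrder Ω]

instance : FunLike (Aut Ω) Ω Ω where
  coe f := RelIso.toEquiv f
  coe_injective f g h := by
    apply RelIso.ext
    exact fun x => congrFun h x

@[ext] theorem ext {f g : Aut Ω} (h : ∀ x, f x = g x) : f = g := DFunLike.ext _ _ h

instance : Group (Aut Ω) where
  mul f g := OrderIso.trans (f : Ω ≃o Ω) (g : Ω ≃o Ω)
  one := OrderIso.refl Ω
  inv f := OrderIso.symm (f : Ω ≃o Ω)
  mul_assoc _ _ _ := rfl
  one_mul _ := rfl
  mul_one _ := rfl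
  inv_mul_cancel f := OrderIso.symm_trans_self (f : Ω ≃o Ω)

@[simp] theorem mul_apply (f g : Aut Ω) (x : Ω) : (f * g) x = g (f x) := rfl
@[simp] theorem one_apply (x : Ω) : (1 : Aut Ω) x = x := rfl

theorem le_iff_le (f : Aut Ω) {x y : Ω} : f x ≤ f y ↔ x ≤ y := OrderIso.le_iff_le (f : Ω ≃o Ω)
theorem mono (f : Aut Ω) : Monotone f := fun _ _ h => (le_iff_le f).2 h

@[simp] theorem apply_inv (f : Aut Ω) (x : Ω) : f (f⁻¹ x) = x :=
  OrderIso.apply_symm_apply (f : Ω ≃o Ω) x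
@[simp] theorem inv_apply (f : Aut Ω) (x : Ω) : f⁻¹ (f x) = x :=
  OrderIso.symm_apply_apply (f : Ω ≃o Ω) x

instance : PartialOrder (Aut Ω) := PartialOrder.lift (fun f => (f : Ω → Ω)) DFunLike.coe_injective

theorem le_def {f g : Aut Ω} : f ≤ g ↔ ∀ x, f x ≤ g x := Iff.rfl

/-- The pointwise supremum; its inverse is the pointwise infimum of the inverses. -/
def sup (f g : Aut Ω) : Aut Ω := StrictMono.orderIsoOfRightInverse (fun x => max (f x) (g x))
    (fun x y h => max_lt_max (((mono f).strictMono_of_injective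
      (RelIso.toEquiv f).injective) h) (((mono g).strictMono_of_injective
      (RelIso.toEquiv g).injective) h))
    (fun y => min (f⁻¹ y) (g⁻¹ y))
    (fun y => by
      rcases le_total (f⁻¹ y) (g⁻¹ y) with h | h
      · have := mono g h
        simp only [apply_inv] at this
        simp [min_eq_left h, this]
      · have := mono f h
        simp only [apply_inv] at this
        simp [min_eq_right h, this])

/-- The pointwise infimum; its inverse is the pointwise supremum of the inverses. -/
def inf (f g : Aut Ω) : Aut Ω := StrictMono.orderIsoOfRightInverse (fun x => min (f x) (g x))
    (fun x y h => min_lt_min (((mono f).strictMono_of_injective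
      (RelIso.toEquiv f).injective) h) (((mono g).strictMono_of_injective
      (RelIso.toEquiv g).injective) h))
    (fun y => max (f⁻¹ y) (g⁻¹ y))
    (fun y => by
      rcases le_total (f⁻¹ y) (g⁻¹ y) with h | h
      · have := mono f h
        simp only [apply_inv] at this
        simp [max_eq_right h, this]
      · have := mono g h
        simp only [apply_inv] at this
        simp [max_eq_left h, this])

instance : Lattice (Aut Ω) where
  sup := sup
  inf := inf
  le_sup_left _ _ _ := le_max_left _ _
  le_sup_right _ _ _ := le_max_right _ _
  sup_le _ _ _ h k x := max_le (h x) (k x)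
  inf_le_left _ _ _ := min_le_left _ _
  inf_le_right _ _ _ := min_le_right _ _
  le_inf _ _ _ h k x := le_min (h x) (k x)

@[simp] theorem sup_apply (f g : Aut Ω) (x : Ω) : (f ⊔ g) x = max (f x) (g x) := rfl
@[simp] theorem inf_apply (f g : Aut Ω) (x : Ω) : (f ⊓ g) x = min (f x) (g x) := rfl

instance : MulLeftMono (Aut Ω) := ⟨fun c _ _ h x => h (c x)⟩
instance : MulRightMono (Aut Ω) := ⟨fun c _ _ h x => mono c (h x)⟩

end Aut

/-! ### Right pre-orders on a partially ordered group -/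

/-- A right pre-order on the partially ordered group `G`, given by its positive cone: a proper
submonoid `C` of `G` with `G⁺ ⊆ C` and `G = C ∪ C⁻¹`. The pre-order is `a ≼ b ↔ b * a⁻¹ ∈ C`. -/
structure PreCone (G : Type*) [Group G] [PartialOrder G] extends Submonoid G where
  pos_mem' : ∀ a : G, 1 ≤ a → a ∈ carrier
  total' : ∀ a : G, a ∈ carrier ∨ a⁻¹ ∈ carrier
  proper' : ∃ a : G, a ∉ carrier

section PreCone

variable {G : Type u} [Group G] [PartialOrder G]

instance : SetLike (PreCone G) G where
  coe C := C.carrier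
  coe_injective C D h := by
    obtain ⟨⟨⟨_, _⟩, _⟩, _, _, _⟩ := C
    obtain ⟨⟨⟨_, _⟩, _⟩, _, _, _⟩ := D
    congr

/-- Pre-cones are ordered by inclusion. -/
instance : PartialOrder (PreCone G) := PartialOrder.lift (fun C => (C : Set G)) SetLike.coe_injective

/-- The set `ℙ(a)` of right pre-orders in which `a` is strictly positive. -/
def PreCone.P (a : G) : Set (PreCone G) := {C | a ∈ C ∧ a⁻¹ ∉ C}

/-- The smallest topology in which all the sets `ℙ(a)` are open. Sets of right pre-orders
carry the subspace topology; it is generated by the traces of the sets `ℙ(a)`. -/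
instance : TopologicalSpace (PreCone G) :=
  TopologicalSpace.generateFrom (Set.range PreCone.P)

namespace PreCone

variable (C : PreCone G)

/-- The set `G` equipped with the right pre-order `C`. -/
def Carrier (_ : PreCone G) : Type u := G

/-- The underlying element of `G`. -/
def toG {C : PreCone G} (a : C.Carrier) : G := a

instance : Preorder C.Carrier where
  le a b := toG b * (toG a)⁻¹ ∈ C
  le_refl a := by
    rw [mul_inv_cancel]
    exact C.one_mem'
  le_trans a b c h k := by
    have := C.mul_mem' k h
    rwa [mul_assoc, inv_mul_cancel_left] at this

instance : Std.Total (α := C.Carrier) (· ≤ ·) where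
  total a b := by
    rcases C.total' (toG b * (toG a)⁻¹) with h | h
    · exact Or.inl h
    · rw [mul_inv_rev, inv_inv] at h
      exact Or.inr h

/-- The chain `Ω_C` of equivalence classes of `G` modulo `a ≼ b ≼ a`. -/
def Omega : Type u := Antisymmetrization C.Carrier (· ≤ ·)

/-- The class `[a]` in `Ω_C`. -/
def cls (a : G) : C.Omega := toAntisymmetrization (α := C.Carrier) (· ≤ ·) a

open Classical in
noncomputable instance : LinearOrder C.Omega :=
  inferInstanceAs (LinearOrder (Antisymmetrization C.Carrier (· ≤ ·)))

theorem cls_le_cls {a b : G} : C.cls a ≤ C.cls b ↔ b * a⁻¹ ∈ C := Iff.rfl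

theorem cls_eq_cls {a b : G} : C.cls a = C.cls b ↔ b * a⁻¹ ∈ C ∧ a * b⁻¹ ∈ C := by
  rw [le_antisymm_iff, cls_le_cls, cls_le_cls]

theorem cls_surjective : Function.Surjective C.cls := fun x => Quotient.inductionOn' x fun a => ⟨a, rfl⟩

/-- The map `[b] ↦ [b * a]` on `Ω_C`. -/
def transl (a : G) : C.Omega → C.Omega :=
  Quotient.map' (fun b : C.Carrier => (toG b * a : G)) (by
    intro b c h
    have h' := C.cls_eq_cls.1 (Quotient.sound' h : C.cls b = C.cls c)
    refine Quotient.exact' (C.cls_eq_cls.2 ?_ : C.cls (toG b * a) = C.cls (toG c * a))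
    have key : ∀ x y : G, x * a * (y * a)⁻¹ = x * y⁻¹ := fun x y => by group
    rwa [key, key])

@[simp] theorem transl_cls (a b : G) : C.transl a (C.cls b) = C.cls (b * a) := rfl

/-- The right regular representation `R_C : G → Aut Ω_C`, given by `R_C(a)([b]) = [b * a]`. -/
noncomputable def R : G →* Aut C.Omega where
  toFun a :=
    { toFun := C.transl a
      invFun := C.transl a⁻¹
      left_inv := fun x => by
        obtain ⟨b, rfl⟩ := C.cls_surjective x
        simp
      right_inv := fun x => by
        obtain ⟨b, rfl⟩ := C.cls_surjective x
        simp
      map_rel_iff' := fun {x y} => by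
        obtain ⟨b, rfl⟩ := C.cls_surjective x
        obtain ⟨c, rfl⟩ := C.cls_surjective y
        simp [cls_le_cls, mul_assoc] }
  map_one' := by
    ext x
    obtain ⟨b, rfl⟩ := C.cls_surjective x
    exact congrArg C.cls (mul_one b)
  map_mul' a b := by
    ext x
    obtain ⟨c, rfl⟩ := C.cls_surjective x
    exact congrArg C.cls (mul_assoc c a b).symm

@[simp] theorem R_apply_cls (a b : G) : C.R a (C.cls b) = C.cls (b * a) := rfl

/-- The `ℓ`-group `H_C`: the `ℓ`-subgroup of `Aut Ω_C` generated by the image of `R_C`. -/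
abbrev H : Type u := lClosure (Set.range C.R)

end PreCone

/-- The space of `V`-right pre-orders on `G`: the right pre-orders `C` with `H_C` in `V`. -/
def rightPreorders (V : LGroupClass.{u}) (G : Type u) [Group G] [PartialOrder G] :
    Set (PreCone G) :=
  {C | V C.H}

/-- The minimal layer: the inclusion-minimal elements of the set of `V`-right pre-orders on `G`. -/
def minimalLayer (V : LGroupClass.{u}) (G : Type u) [Group G] [PartialOrder G] :
    Set (PreCone G) :=
  {C | Minimal (· ∈ rightPreorders V G) C}

/-- The space of right orders on `G`: the right pre-orders `C` with `C ∩ C⁻¹ = {1}`, that is, the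
right-invariant proper total orders extending the order of `G`. -/
def rightOrders (G : Type u) [Group G] [PartialOrder G] : Set (PreCone G) :=
  {C | ∀ a : G, a ∈ C → a⁻¹ ∈ C → a = 1}

/-- The space of orders on `G`: the right orders that are also left invariant, that is, whose
positive cone is closed under conjugation. -/
def orders (G : Type u) [Group G] [PartialOrder G] : Set (PreCone G) :=
  {C | C ∈ rightOrders G ∧ ∀ a ∈ C, ∀ b : G, b * a * b⁻¹ ∈ C}

end PreCone

/-! ### The free `ℓ`-group over a partially ordered group -/

/-- `ℓ`-group terms over `G`. -/
inductive Term (G : Type u) : Type u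
  | of : G → Term G
  | one : Term G
  | mul : Term G → Term G → Term G
  | inv : Term G → Term G
  | sup : Term G → Term G → Term G
  | inf : Term G → Term G → Term G

/-- The value of a term in an `ℓ`-group. -/
def Term.eval {G : Type u} {H : Type*} [Group H] [Lattice H] (p : G → H) : Term G → H
  | .of a => p a
  | .one => 1
  | .mul s t => s.eval p * t.eval p
  | .inv t => (t.eval p)⁻¹
  | .sup s t => s.eval p ⊔ t.eval p
  | .inf s t => s.eval p ⊓ t.eval p

section Free

variable (V : LGroupClass.{u}) (G : Type u) [Group G] [PartialOrder G]

/-- Two terms are identified if they have equal values under all positive homomorphisms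
from `G` to `ℓ`-groups in `V`. -/
def termSetoid : Setoid (Term G) where
  r s t := ∀ (H : Type u) [Group H] [Lattice H] [MulLeftMono H] [MulRightMono H], V H →
    ∀ p : G →* H, Monotone p → s.eval p = t.eval p
  iseqv :=
    { refl := fun _ _ _ _ _ _ _ _ _ => rfl
      symm := fun h H _ _ _ _ hV p hp => (h H hV p hp).symm
      trans := fun h k H _ _ _ _ hV p hp => (h H hV p hp).trans (k H hV p hp) }

/-- The `ℓ`-group `F_V(G)` freely generated by the partially ordered group `G` in `V`. -/
def Free : Type u := Quotient (termSetoid V G)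

namespace Free

variable {V G}

/-- The class of a term. -/
def mk (t : Term G) : Free V G := Quotient.mk (termSetoid V G) t

/-- The map `F_V(G) → H` induced by a positive homomorphism `p : G → H`. -/
def ev {H : Type u} [Group H] [Lattice H] [MulLeftMono H] [MulRightMono H] (hV : V H)
    (p : G →* H) (hp : Monotone p) : Free V G → H :=
  Quotient.lift (fun t => t.eval p) (fun _ _ h => h H hV p hp)

theorem ext {x y : Free V G}
    (h : ∀ (H : Type u) [Group H] [Lattice H] [MulLeftMono H] [MulRightMono H] (hV : V H)
      (p : G →* H) (hp : Monotone p), ev hV p hp x = ev hV p hp y) : x = y := by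
  induction x using Quotient.inductionOn
  induction y using Quotient.inductionOn
  exact Quotient.sound fun H _ _ _ _ hV p hp => h H hV p hp

instance : One (Free V G) := ⟨mk .one⟩
instance : Mul (Free V G) :=
  ⟨Quotient.map₂ Term.mul fun _ _ h _ _ k H _ _ _ _ hV p hp =>
    congrArg₂ (· * ·) (h H hV p hp) (k H hV p hp)⟩
instance : Inv (Free V G) :=
  ⟨Quotient.map Term.inv fun _ _ h H _ _ _ _ hV p hp => congrArg (·⁻¹) (h H hV p hp)⟩
/-- The join of `F_V(G)`. -/
def sup : Free V G → Free V G → Free V G :=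
  Quotient.map₂ Term.sup fun _ _ h _ _ k H _ _ _ _ hV p hp =>
    congrArg₂ (· ⊔ ·) (h H hV p hp) (k H hV p hp)

/-- The meet of `F_V(G)`. -/
def inf : Free V G → Free V G → Free V G :=
  Quotient.map₂ Term.inf fun _ _ h _ _ k H _ _ _ _ hV p hp =>
    congrArg₂ (· ⊓ ·) (h H hV p hp) (k H hV p hp)

section ev

variable {H : Type u} [Group H] [Lattice H] [MulLeftMono H] [MulRightMono H] (hV : V H)
    (p : G →* H) (hp : Monotone p)

@[simp] theorem ev_mk (t : Term G) : ev hV p hp (mk t) = t.eval p := rfl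
@[simp] theorem ev_one : ev hV p hp 1 = 1 := rfl
@[simp] theorem ev_mul (x y : Free V G) :
    ev hV p hp (x * y) = ev hV p hp x * ev hV p hp y := by
  induction x using Quotient.inductionOn
  induction y using Quotient.inductionOn
  rfl
@[simp] theorem ev_inv (x : Free V G) : ev hV p hp x⁻¹ = (ev hV p hp x)⁻¹ := by
  induction x using Quotient.inductionOn
  rfl
theorem ev_sup' (x y : Free V G) :
    ev hV p hp (sup x y) = ev hV p hp x ⊔ ev hV p hp y := by
  induction x using Quotient.inductionOn
  induction y using Quotient.inductionOn
  rfl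
theorem ev_inf' (x y : Free V G) :
    ev hV p hp (inf x y) = ev hV p hp x ⊓ ev hV p hp y := by
  induction x using Quotient.inductionOn
  induction y using Quotient.inductionOn
  rfl

end ev

instance : Group (Free V G) where
  mul_assoc x y z := ext fun H _ _ _ _ hV p hp => by simp [mul_assoc]
  one_mul x := ext fun H _ _ _ _ hV p hp => by simp
  mul_one x := ext fun H _ _ _ _ hV p hp => by simp
  inv_mul_cancel x := ext fun H _ _ _ _ hV p hp => by simp

/-- The order of `F_V(G)` is determined by its join. -/
theorem sup_eq_iff {x y : Free V G} : sup x y = y ↔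
    ∀ (H : Type u) [Group H] [Lattice H] [MulLeftMono H] [MulRightMono H] (hV : V H)
      (p : G →* H) (hp : Monotone p), ev hV p hp x ≤ ev hV p hp y := by
  constructor
  · intro h H _ _ _ _ hV p hp
    rw [← sup_eq_right, ← ev_sup', h]
  · intro h
    refine ext fun H _ _ _ _ hV p hp => ?_
    rw [ev_sup', sup_eq_right]
    exact h H hV p hp

instance : Lattice (Free V G) where
  le x y := sup x y = y
  le_refl x := sup_eq_iff.2 fun H _ _ _ _ hV p hp => le_rfl
  le_trans x y z h k := sup_eq_iff.2 fun H _ _ _ _ hV p hp =>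
    (sup_eq_iff.1 h H hV p hp).trans (sup_eq_iff.1 k H hV p hp)
  le_antisymm x y h k := ext fun H _ _ _ _ hV p hp =>
    (sup_eq_iff.1 h H hV p hp).antisymm (sup_eq_iff.1 k H hV p hp)
  sup := sup
  le_sup_left x y := sup_eq_iff.2 fun H _ _ _ _ hV p hp => by
    rw [ev_sup']; exact le_sup_left
  le_sup_right x y := sup_eq_iff.2 fun H _ _ _ _ hV p hp => by
    rw [ev_sup']; exact le_sup_right
  sup_le x y z h k := sup_eq_iff.2 fun H _ _ _ _ hV p hp => by
    rw [ev_sup']; exact sup_le (sup_eq_iff.1 h H hV p hp) (sup_eq_iff.1 k H hV p hp)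
  inf := inf
  inf_le_left x y := sup_eq_iff.2 fun H _ _ _ _ hV p hp => by
    rw [ev_inf']; exact inf_le_left
  inf_le_right x y := sup_eq_iff.2 fun H _ _ _ _ hV p hp => by
    rw [ev_inf']; exact inf_le_right
  le_inf x y z h k := sup_eq_iff.2 fun H _ _ _ _ hV p hp => by
    rw [ev_inf']; exact le_inf (sup_eq_iff.1 h H hV p hp) (sup_eq_iff.1 k H hV p hp)

@[simp] theorem ev_sup {H : Type u} [Group H] [Lattice H] [MulLeftMono H] [MulRightMono H]
    (hV : V H) (p : G →* H) (hp : Monotone p) (x y : Free V G) :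
    ev hV p hp (x ⊔ y) = ev hV p hp x ⊔ ev hV p hp y := ev_sup' hV p hp x y

@[simp] theorem ev_inf {H : Type u} [Group H] [Lattice H] [MulLeftMono H] [MulRightMono H]
    (hV : V H) (p : G →* H) (hp : Monotone p) (x y : Free V G) :
    ev hV p hp (x ⊓ y) = ev hV p hp x ⊓ ev hV p hp y := ev_inf' hV p hp x y

theorem le_iff_ev {x y : Free V G} : x ≤ y ↔
    ∀ (H : Type u) [Group H] [Lattice H] [MulLeftMono H] [MulRightMono H] (hV : V H)
      (p : G →* H) (hp : Monotone p), ev hV p hp x ≤ ev hV p hp y := sup_eq_iff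

instance : MulLeftMono (Free V G) := ⟨fun c x y h => by
  rw [le_iff_ev] at h ⊢
  intro H _ _ _ _ hV p hp
  simp only [ev_mul]
  exact mul_le_mul_right (h H hV p hp) _⟩

instance : MulRightMono (Free V G) := ⟨fun c x y h => by
  rw [le_iff_ev] at h
  refine le_iff_ev.2 fun H _ _ _ _ hV p hp => ?_
  change ev hV p hp (x * c) ≤ ev hV p hp (y * c)
  simp only [ev_mul]
  exact mul_le_mul_left (h H hV p hp) _⟩

end Free

variable {G}

/-- The universal map `η : G → F_V(G)`. -/
def eta : G →* Free V G where
  toFun a := Free.mk (.of a)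
  map_one' := Free.ext fun H _ _ _ _ hV p hp => by simp [Term.eval]
  map_mul' a b := Free.ext fun H _ _ _ _ hV p hp => by simp [Term.eval]

theorem eta_monotone : Monotone (eta V : G → Free V G) := fun _ _ h =>
  Free.le_iff_ev.2 fun _ _ _ _ _ _ _ hp => hp h

/-- The universal property of `η`. -/
theorem eta_universal {H : Type u} [Group H] [Lattice H] [MulLeftMono H] [MulRightMono H]
    (hV : V H) (p : G →* H) (hp : Monotone p) :
    ∃! h : Free V G →* H, IsLHom h ∧ ∀ a, h (eta V a) = p a := by
  refine ⟨⟨⟨Free.ev hV p hp, Free.ev_one hV p hp⟩, Free.ev_mul hV p hp⟩,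
    ⟨⟨Free.ev_sup hV p hp, Free.ev_inf hV p hp⟩, fun _ => rfl⟩, ?_⟩
  rintro k ⟨⟨hs, hi⟩, ha⟩
  ext x
  change k x = Free.ev hV p hp x
  induction x using Quotient.inductionOn with | _ t
  change k (Free.mk t) = Free.ev hV p hp (Free.mk t)
  induction t with
  | of a => exact ha a
  | one => exact map_one k
  | mul s t h1 h2 => exact (map_mul k (Free.mk s) (Free.mk t)).trans (congrArg₂ (· * ·) h1 h2)
  | inv t h1 => exact (map_inv k (Free.mk t)).trans (congrArg (·⁻¹) h1)
  | sup s t h1 h2 => exact (hs (Free.mk s) (Free.mk t)).trans (congrArg₂ (· ⊔ ·) h1 h2)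
  | inf s t h1 h2 => exact (hi (Free.mk s) (Free.mk t)).trans (congrArg₂ (· ⊓ ·) h1 h2)

/-- `F_V(G)` lies in `V` for each of the three varieties. -/
theorem free_all_mem : allLGroups (Free allLGroups G) := trivial

theorem free_abelian_mem : abelianLGroups (Free abelianLGroups G) := fun x y =>
  Free.ext fun H _ _ _ _ hV p hp => by
    rw [Free.ev_mul, Free.ev_mul]
    exact hV _ _

theorem free_representable_mem : representableLGroups (Free representableLGroups G) := by
  classical
  have key : ∀ z : {z : Free representableLGroups G × Free representableLGroups G // z.1 ≠ z.2},
      ∃ (L : Type u) (_ : Group L) (_ : LinearOrder L) (_ : MulLeftMono L) (_ : MulRightMono L)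
        (f : Free representableLGroups G →* L),
        IsLHom f ∧ Function.Surjective f ∧ f z.1.1 ≠ f z.1.2 := by
    rintro ⟨⟨x, y⟩, hxy⟩
    by_contra! hcon
    refine hxy (Free.ext fun H _ _ _ _ hV p hp => ?_)
    obtain ⟨ι, L, _, _, _, _, f, hf, -, hinj⟩ := id hV
    refine hinj _ _ fun i => ?_
    let g : Free representableLGroups G →* L i :=
      (f i).comp ⟨⟨Free.ev hV p hp, Free.ev_one hV p hp⟩, Free.ev_mul hV p hp⟩
    have hg : IsLHom g :=
      ⟨fun a b => (congrArg (f i) (Free.ev_sup hV p hp a b)).trans ((hf i).1 _ _),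
        fun a b => (congrArg (f i) (Free.ev_inf hV p hp a b)).trans ((hf i).2 _ _)⟩
    have hres := hcon g.range inferInstance inferInstance inferInstance inferInstance
      g.rangeRestrict ⟨fun a b => ?_, fun a b => ?_⟩ g.rangeRestrict_surjective
    · exact congrArg Subtype.val hres
    · apply Subtype.ext
      rcases le_total (g.rangeRestrict a) (g.rangeRestrict b) with hab | hab
      · rw [sup_eq_right.2 hab]
        exact (hg.1 a b).trans (sup_eq_right.2 hab)
      · rw [sup_eq_left.2 hab]
        exact (hg.1 a b).trans (sup_eq_left.2 hab)
    · apply Subtype.ext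
      rcases le_total (g.rangeRestrict a) (g.rangeRestrict b) with hab | hab
      · rw [inf_eq_left.2 hab]
        exact (hg.2 a b).trans (inf_eq_left.2 hab)
      · rw [inf_eq_right.2 hab]
        exact (hg.2 a b).trans (inf_eq_right.2 hab)
  choose L i1 i2 i3 i4 f hf hs hne using key
  refine ⟨_, L, i1, i2, i3, i4, f, hf, hs, fun x y h => ?_⟩
  by_contra hxy
  exact hne ⟨(x, y), hxy⟩ (h ⟨(x, y), hxy⟩)

end Free

/-! ### Polars -/

section Polar

variable {H : Type*} [Group H] [Lattice H]

/-- `S^⊥`, the set of elements orthogonal to all elements of `S`. -/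
def polar (S : Set H) : Set H := {x | ∀ y ∈ S, |x|ₘ ⊓ |y|ₘ = 1}

variable (H) in
/-- The set of polars of `H`. -/
def polars : Set (Set H) := {T | ∃ S : Set H, T = polar S}

variable (H) in
/-- The set of principal polars `x^⊥⊥` of `H`, ordered by inclusion. -/
def principalPolars : Set (Set H) := {T | ∃ x : H, T = polar (polar {x})}

/-- `P` is a Boolean subalgebra of the Boolean algebra of polars of `H`, in which the order is
inclusion, the meet is intersection, the join is `(S ∪ T)^⊥⊥` and the complement is `T^⊥`. -/
structure IsBooleanSubalgebraOfPolars (P : Set (Set H)) : Prop where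
  subset : P ⊆ polars H
  top_mem : Set.univ ∈ P
  bot_mem : {1} ∈ P
  inf_mem : ∀ S ∈ P, ∀ T ∈ P, S ∩ T ∈ P
  sup_mem : ∀ S ∈ P, ∀ T ∈ P, polar (polar (S ∪ T)) ∈ P
  compl_mem : ∀ T ∈ P, polar T ∈ P

end Polar

/-! ### Stone duality -/

/-- The Stone dual `X(D)` of a lattice `D`: the space of its prime ideals. -/
def StoneDual (D : Type*) [Preorder D] : Type _ := {I : Order.Ideal D // I.IsPrime}

/-- The Stone topology has the sets of the prime ideals that omit a given `a : D` as a subbase. -/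
instance (D : Type*) [Preorder D] : TopologicalSpace (StoneDual D) :=
  TopologicalSpace.generateFrom (Set.range fun a : D => {I | a ∉ I.1})

/-- A Stone space: a compact Hausdorff totally disconnected space. -/
def IsStoneSpace (X : Type*) [TopologicalSpace X] : Prop :=
  CompactSpace X ∧ T2Space X ∧ TotallyDisconnectedSpace X

end LGrp

open LGrp

/-! Call C a kernel order if C ∩ C⁻¹ = ker η and, for the representable and Abelian varieties (the
case `Q`), C is closed under conjugation. The minimal layer consists exactly of the kernel orders
(`IsTame.minimalLayer_eq`). If H_C ∈ V, then F_V(G) acts on Ω_C, so C contains every a with η(a) ≥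
1; hence no V-right pre-order lies strictly below a kernel order. Conversely, every V-right
pre-order contains a kernel pre-order, and Zorn's lemma yields a minimal one D; if D had ties
outside ker η, breaking one of them by a second kernel pre-order would shrink D.

Ultrafilter limits of kernel orders are kernel orders, which gives compactness, and the clopen sets
{C : a ∈ C} separate points. Since ker η is the full set of ties, η carries kernel orders
bijectively to right orders, or orders, on η[G].

For x in F_V(G), let supp x be the set of kernel orders C for which x moves [1] ∈ Ω_C. Near a given
C, x sends [1] to [g] for one fixed g ∈ G, so supp x is clopen. Supports turn |x| ⊓ |y| and |x| ⊔
|y| into intersection and union, and supp x is empty only for x = 1; by compactness every clopen set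
is a support. Hence x^⊥⊥ = {z : supp z ⊆ supp x}, the principal polars form the clopen algebra, and
Stone duality applies.

Only `IsTame` depends on V: kernel pre-orders detect nontrivial terms at [1], are V-right
pre-orders, and lie below every V-right pre-order. Detection uses maximal filter bases of positive
elements in an ℓ-group, or the factors of a subdirect product of chains; in the representable case
the pre-orders below C come from an ultrafilter on the index set. -/

namespace LGrp

/-! ### Basic facts on pre-cones, induced maps of chains, and terms. -/

namespace PreCone

section

variable {G : Type*} [Group G] [PartialOrder G] (C : PreCone G)

theorem one_mem : (1 : G) ∈ C := C.one_mem'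

theorem mul_mem {a b : G} (ha : a ∈ C) (hb : b ∈ C) : a * b ∈ C := C.mul_mem' ha hb

theorem total (a : G) : a ∈ C ∨ a⁻¹ ∈ C := C.total' a

theorem mem_of_one_le {a : G} (ha : 1 ≤ a) : a ∈ C := C.pos_mem' a ha

theorem inv_mem_of_notMem {a : G} (ha : a ∉ C) : a⁻¹ ∈ C := (C.total a).resolve_left ha

@[ext] theorem ext {C D : PreCone G} (h : ∀ a, a ∈ C ↔ a ∈ D) : C = D := SetLike.ext h

/-- The inverse image of a pre-cone under a positive homomorphism. -/
def comap {H : Type*} [Group H] [PartialOrder H] (p : G →* H) (hp : Monotone p) (D : PreCone H)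
    (h : ∃ a, p a ∉ D) : PreCone G where
  carrier := {a | p a ∈ D}
  one_mem' := by simpa using D.one_mem
  mul_mem' ha hb := by simpa using D.mul_mem ha hb
  pos_mem' a ha := D.mem_of_one_le (by simpa using hp ha)
  total' a := by simpa using D.total (p a)
  proper' := h

@[simp] theorem mem_comap {H : Type*} [Group H] [PartialOrder H] {p : G →* H} {hp : Monotone p}
    {D : PreCone H} {h : ∃ a, p a ∉ D} {a : G} : a ∈ comap p hp D h ↔ p a ∈ D := Iff.rfl

end

section

variable {G : Type u} [Group G] [PartialOrder G] (C : PreCone G)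
variable {H : Type u} [Group H] [PartialOrder H] (D : PreCone H)

theorem cls_one_le {a : G} : C.cls 1 ≤ C.cls a ↔ a ∈ C := by simp [cls_le_cls]

theorem cls_le_one {a : G} : C.cls a ≤ C.cls 1 ↔ a⁻¹ ∈ C := by simp [cls_le_cls]

theorem cls_eq_one {a : G} : C.cls a = C.cls 1 ↔ a ∈ C ∧ a⁻¹ ∈ C := by
  simp [cls_eq_cls, and_comm]

/-- The map `[a] ↦ [p a]` of chains induced by a homomorphism that preserves the cones. -/
def omegaMap (p : G →* H) (h : ∀ a ∈ C, p a ∈ D) : C.Omega → D.Omega :=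
  Quotient.map' (fun b : C.Carrier => (p (toG b) : H)) (by
    intro b c hbc
    have h' := C.cls_eq_cls.1 (Quotient.sound' hbc : C.cls b = C.cls c)
    refine Quotient.exact' (D.cls_eq_cls.2 ?_ : D.cls (p (toG b)) = D.cls (p (toG c)))
    rw [← map_inv, ← map_inv, ← map_mul, ← map_mul]
    exact ⟨h _ h'.1, h _ h'.2⟩)

@[simp] theorem omegaMap_cls (p : G →* H) (h : ∀ a ∈ C, p a ∈ D) (a : G) :
    C.omegaMap D p h (C.cls a) = D.cls (p a) := rfl

theorem omegaMap_monotone (p : G →* H) (h : ∀ a ∈ C, p a ∈ D) : Monotone (C.omegaMap D p h) := by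
  intro x y hxy
  obtain ⟨a, rfl⟩ := C.cls_surjective x
  obtain ⟨b, rfl⟩ := C.cls_surjective y
  rw [cls_le_cls] at hxy
  simpa [cls_le_cls] using h _ hxy

end

end PreCone

namespace Aut

variable {Ω : Type*} [LinearOrder Ω]

theorem injective (f : Aut Ω) : Function.Injective f := fun x y h => by
  simpa using congrArg (f⁻¹ : Aut Ω) h

end Aut

namespace Term

/-- Monotone equivariant maps between chains on which `G` acts commute with all terms. -/
theorem eval_equivariant {G : Type u} {Ω Ω' : Type*} [LinearOrder Ω] [LinearOrder Ω'] {π : Ω → Ω'}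
    (hπ : Monotone π) {ρ : G → Aut Ω} {ρ' : G → Aut Ω'} (h : ∀ a x, π (ρ a x) = ρ' a (π x))
    (t : Term G) (x : Ω) : π (t.eval ρ x) = t.eval ρ' (π x) := by
  induction t generalizing x with
  | of a => exact h a x
  | one => rfl
  | mul s t hs ht => simp [eval, hs, ht]
  | inv t ht =>
    -- Applying the automorphism on both sides turns the claim for the inverse into the induction
    -- hypothesis.
    apply (t.eval ρ').injective
    simp [eval, ← ht]
  | sup s t hs ht => simp [eval, hs, ht, hπ.map_max]
  | inf s t hs ht => simp [eval, hs, ht, hπ.map_min]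

theorem map_eval {G : Type u} {H K : Type*} [Group H] [Lattice H] [Group K] [Lattice K]
    {f : H →* K} (hf : IsLHom f) (p : G → H) (t : Term G) :
    f (t.eval p) = t.eval (fun a => f (p a)) := by
  induction t with
  | of a => rfl
  | one => exact map_one f
  | mul s t hs ht => simp [eval, hs, ht]
  | inv t ht => simp [eval, ht]
  | sup s t hs ht => simp [eval, hs, ht, hf.1]
  | inf s t hs ht => simp [eval, hs, ht, hf.2]

end Term

/-- Inversion exchanges joins and meets. -/
theorem isLHom_of_sup {H K : Type*} [Group H] [Lattice H] [MulLeftMono H] [MulRightMono H]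
    [Group K] [Lattice K] [MulLeftMono K] [MulRightMono K] {f : H →* K}
    (h : ∀ a b, f (a ⊔ b) = f a ⊔ f b) : IsLHom f := by
  refine ⟨h, fun a b => inv_injective ?_⟩
  rw [← map_inv, inv_inf, h, inv_inf, map_inv, map_inv]

/-! ### Lattice pre-cones on `ℓ`-groups -/

/-- A maximal filter base of strictly positive elements containing `x`. -/
theorem exists_ultrafilter_base {H : Type*} [Group H] [Lattice H] {x : H}
    (hx : 1 ≤ x) (hx1 : x ≠ 1) :
    ∃ U : Set H, x ∈ U ∧ (∀ u ∈ U, 1 ≤ u) ∧ 1 ∉ U ∧ (∀ u ∈ U, ∀ v ∈ U, u ⊓ v ∈ U) ∧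
      ∀ v, 1 ≤ v → (∃ u ∈ U, v ⊓ u = 1) ∨ ∃ u ∈ U, v ⊓ u ∈ U := by
  obtain ⟨U, hxU, hU⟩ := zorn_subset_nonempty
    {U : Set H | (∀ u ∈ U, 1 ≤ u) ∧ 1 ∉ U ∧ ∀ u ∈ U, ∀ v ∈ U, u ⊓ v ∈ U} (by
      intro c hc hchain _
      refine ⟨⋃₀ c, ⟨?_, ?_, ?_⟩, fun s hs => Set.subset_sUnion_of_mem hs⟩
      · rintro u ⟨s, hs, hus⟩
        exact (hc hs).1 u hus
      · rintro ⟨s, hs, h1⟩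
        exact (hc hs).2.1 h1
      · rintro u ⟨s, hs, hus⟩ v ⟨s', hs', hvs'⟩
        rcases hchain.total hs hs' with h | h
        · exact ⟨s', hs', (hc hs').2.2 u (h hus) v hvs'⟩
        · exact ⟨s, hs, (hc hs).2.2 u hus v (h hvs')⟩)
    {x} ⟨by simpa using hx, by simpa using hx1.symm, by simp⟩
  refine ⟨U, hxU rfl, hU.prop.1, hU.prop.2.1, hU.prop.2.2, fun v hv => ?_⟩
  by_contra! hcon
  -- If no v ⊓ u equals 1, adjoining all v ⊓ u to U keeps it an admissible filter base; maximality
  -- puts v ⊓ x into U.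
  refine hcon.2 x (hxU rfl) (hU.le_of_ge (y := U ∪ (v ⊓ ·) '' U) ⟨?_, ?_, ?_⟩
    Set.subset_union_left (Or.inr ⟨x, hxU rfl, rfl⟩))
  · rintro u (hu | ⟨u, hu, rfl⟩)
    · exact hU.prop.1 u hu
    · exact le_inf hv (hU.prop.1 u hu)
  · rintro (h | ⟨u, hu, h⟩)
    · exact hU.prop.2.1 h
    · exact hcon.1 u hu h
  · rintro u (hu | ⟨u, hu, rfl⟩) w (hw | ⟨w, hw, rfl⟩)
    · exact Or.inl (hU.prop.2.2 u hu w hw)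
    · exact Or.inr ⟨_, hU.prop.2.2 u hu w hw, inf_left_comm v u w⟩
    · exact Or.inr ⟨_, hU.prop.2.2 u hu w hw, (inf_assoc v u w).symm⟩
    · exact Or.inr ⟨_, hU.prop.2.2 u hu w hw, inf_inf_distrib_left v u w⟩

theorem eq_one_of_mabs_eq_one {H : Type*} [Group H] [Lattice H] [MulLeftMono H] {x : H}
    (h : |x|ₘ = 1) : x = 1 :=
  le_antisymm (h ▸ le_mabs_self x) (inv_le_one'.1 (h ▸ inv_le_mabs x))

section LatticePreCone

variable {H : Type u} [Group H] [Lattice H] [MulLeftMono H] [MulRightMono H]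

/-- If the cone `C` satisfies `a ∈ C → a ⊓ 1 ∈ C`, then the right regular representation is an
`ℓ`-homomorphism. -/
theorem PreCone.isLHom_R {C : PreCone H} (hC : ∀ a ∈ C, a ⊓ 1 ∈ C) : IsLHom C.R := by
  -- Joins in H become maxima of classes because b * (a ⊔ b)⁻¹ = b * a⁻¹ ⊓ 1.
  have key : ∀ a b : H, C.cls a ≤ C.cls b → C.cls (a ⊔ b) = C.cls b := by
    intro a b hab
    refine le_antisymm ?_ ?_
    · rw [C.cls_le_cls] at hab ⊢
      have := hC _ hab
      rwa [show b * (a ⊔ b)⁻¹ = b * a⁻¹ ⊓ 1 by rw [inv_sup, mul_inf, mul_inv_cancel]]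
    · rw [C.cls_le_cls]
      exact C.mem_of_one_le (by simp)
  refine isLHom_of_sup fun a b => Aut.ext fun x => ?_
  obtain ⟨c, rfl⟩ := C.cls_surjective x
  simp only [PreCone.R_apply_cls, Aut.sup_apply, mul_sup]
  rcases le_total (C.cls (c * a)) (C.cls (c * b)) with h | h
  · rw [max_eq_right h, key _ _ h]
  · rw [max_eq_left h, sup_comm, key _ _ h]

/-- From u ≤ u * b, the meet is bounded by (a ⊓ u) * b = b. -/
theorem mul_inf_eq_one {a b u : H} (hb : 1 ≤ b) (ha : 1 ≤ a) (hu : 1 ≤ u) (hau : a ⊓ u = 1)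
    (hbu : b ⊓ u = 1) : a * b ⊓ u = 1 := by
  refine le_antisymm ?_ (le_inf (one_le_mul ha hb) hu)
  rw [← hbu]
  refine le_inf ?_ inf_le_right
  calc a * b ⊓ u ≤ a * b ⊓ u * b := inf_le_inf_left _ (le_mul_of_one_le_right' hb)
    _ = b := by rw [← inf_mul, hau, one_mul]

/-- Positive and negative parts are orthogonal: the meet factors as (h⁻¹ ⊓ 1) * (h ⊔ 1), and the
first factor is the inverse of the second. -/
theorem inv_sup_one_inf_sup_one (h : H) : (h⁻¹ ⊔ 1) ⊓ (h ⊔ 1) = 1 := by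
  have h1 : h⁻¹ ⊔ 1 = h⁻¹ * (h ⊔ 1) := by rw [mul_sup, inv_mul_cancel, mul_one, sup_comm]
  have h2 : (h⁻¹ ⊔ 1) ⊓ (h ⊔ 1) = (h⁻¹ ⊓ 1) * (h ⊔ 1) := by rw [inf_mul, one_mul, ← h1]
  rw [h2, ← inv_inv (h ⊔ 1), inv_sup, inv_one, mul_inv_cancel]

/-- Every nontrivial element of an `ℓ`-group moves the base point in some lattice-ordered right
regular representation. -/
theorem exists_preCone_cls_ne {x : H} (hx : x ≠ 1) :
    ∃ C : PreCone H, (∀ a ∈ C, a ⊓ 1 ∈ C) ∧ C.cls x ≠ C.cls 1 := by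
  obtain ⟨U, hxU, hpos, h1, hinf, hmax⟩ :=
    exists_ultrafilter_base (one_le_mabs x) (fun h => hx (eq_one_of_mabs_eq_one h))
  have hxC : ¬ ∃ u ∈ U, (|x|ₘ⁻¹⁻¹ ⊔ 1) ⊓ u = 1 := by
    rintro ⟨u, hu, h⟩
    rw [inv_inv, sup_eq_left.2 (one_le_mabs x)] at h
    exact h1 (h ▸ hinf _ hxU _ hu)
  -- C consists of the h whose negative part is orthogonal to some member of U. It is total because,
  -- if h ⊔ 1 is orthogonal to no member of U, some (h ⊔ 1) ⊓ u lies in U and is orthogonal to h⁻¹ ⊔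
  -- 1. As |x| ∈ U, the inverse of |x| is not in C.
  let C : PreCone H :=
    { carrier := {h | ∃ u ∈ U, (h⁻¹ ⊔ 1) ⊓ u = 1}
      one_mem' := ⟨_, hxU, by simp [one_le_mabs x]⟩
      mul_mem' := by
        rintro a b ⟨u, hu, hau⟩ ⟨v, hv, hbv⟩
        refine ⟨u ⊓ v, hinf u hu v hv, ?_⟩
        have huv := hpos _ (hinf u hu v hv)
        have h2 : (b⁻¹ ⊔ 1) * (a⁻¹ ⊔ 1) ⊓ (u ⊓ v) = 1 := by
          refine mul_inf_eq_one le_sup_right le_sup_right huv ?_ ?_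
          · exact le_antisymm ((inf_le_inf_left _ inf_le_right).trans hbv.le) (le_inf le_sup_right huv)
          · exact le_antisymm ((inf_le_inf_left _ inf_le_left).trans hau.le) (le_inf le_sup_right huv)
        refine le_antisymm ((inf_le_inf_right _ (sup_le ?_ ?_)).trans h2.le) (le_inf le_sup_right huv)
        · rw [mul_inv_rev]
          exact mul_le_mul' le_sup_left le_sup_left
        · exact one_le_mul le_sup_right le_sup_right
      pos_mem' := fun a ha => ⟨_, hxU, by
        rw [sup_eq_right.2 (inv_le_one'.2 ha)]
        simp [one_le_mabs x]⟩
      total' := fun a => by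
        rcases hmax (a ⊔ 1) le_sup_right with ⟨u, hu, h⟩ | ⟨u, hu, h⟩
        · exact Or.inr ⟨u, hu, by rwa [inv_inv]⟩
        · refine Or.inl ⟨_, h, ?_⟩
          rw [← inf_assoc, inv_sup_one_inf_sup_one, inf_eq_left]
          exact hpos u hu
      proper' := ⟨_, hxC⟩ }
  have hC : ∀ a ∈ C, a ⊓ 1 ∈ C := by
    rintro a ⟨u, hu, h⟩
    exact ⟨u, hu, by rwa [inv_inf, inv_one, sup_assoc, sup_idem]⟩
  refine ⟨C, hC, fun h => hxC ?_⟩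
  -- If x fixed [1], so would x⁻¹ and |x| = x ⊔ x⁻¹, forcing |x|⁻¹ ∈ C.
  have h3 : C.R x (C.cls 1) = C.cls 1 := by simpa using h
  have h4 : C.R x⁻¹ (C.cls 1) = C.cls 1 := by
    rw [map_inv]
    exact (C.R x).injective (by rw [Aut.apply_inv, h3])
  have h5 : C.R |x|ₘ (C.cls 1) = C.cls 1 := by
    rw [mabs, (PreCone.isLHom_R hC).1, Aut.sup_apply, h3, h4, max_self]
  rw [PreCone.R_apply_cls, one_mul] at h5
  exact (C.cls_eq_one.1 h5).2

end LatticePreCone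

/-! ### Principal polars and support maps -/

section Support

variable {H B : Type*} [Group H] [Lattice H] [BooleanAlgebra B]

/-- A surjection onto a Boolean algebra that turns orthogonality into disjointness. -/
structure IsSupportMap (D : H → B) : Prop where
  surj : Function.Surjective D
  disjoint_iff : ∀ x y, Disjoint (D x) (D y) ↔ |x|ₘ ⊓ |y|ₘ = 1

namespace IsSupportMap

variable {D : H → B} (hD : IsSupportMap D)
include hD

theorem eq_bot_iff [MulLeftMono H] {x : H} : D x = ⊥ ↔ x = 1 := by
  rw [← disjoint_self, hD.disjoint_iff, inf_idem]
  exact ⟨eq_one_of_mabs_eq_one, fun h => by simp [h, mabs]⟩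

theorem mem_polar {S : Set H} {y : H} : y ∈ polar S ↔ ∀ x ∈ S, Disjoint (D y) (D x) :=
  forall₂_congr fun x _ => (hD.disjoint_iff y x).symm

/-- By surjectivity some z has D z = b, and orthogonality to this single element already forces D y
≤ bᶜ. -/
theorem polar_setOf_le (b : B) : polar {z | D z ≤ b} = {z | D z ≤ bᶜ} := by
  ext y
  rw [hD.mem_polar, Set.mem_ofPred_eq, le_compl_iff_disjoint_right]
  refine ⟨fun h => ?_, fun h x hx => h.mono_right hx⟩
  obtain ⟨x, rfl⟩ := hD.surj b
  exact h x le_rfl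

theorem polar_singleton (x : H) : polar {x} = {z | D z ≤ (D x)ᶜ} := by
  ext y
  rw [hD.mem_polar, Set.mem_ofPred_eq, le_compl_iff_disjoint_right]
  simp

theorem polar_polar_singleton (x : H) : polar (polar {x}) = {z | D z ≤ D x} := by
  rw [hD.polar_singleton, hD.polar_setOf_le, compl_compl]

theorem mem_principalPolars {T : Set H} : T ∈ principalPolars H ↔ ∃ b, T = {z | D z ≤ b} := by
  constructor
  · rintro ⟨x, rfl⟩
    exact ⟨D x, hD.polar_polar_singleton x⟩
  · rintro ⟨b, rfl⟩
    obtain ⟨x, rfl⟩ := hD.surj b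
    exact ⟨x, (hD.polar_polar_singleton x).symm⟩

/-- The principal polars are the sets {z | D z ≤ b}, so each polar operation is read off from the
operation of B on the bounds b. -/
theorem isBooleanSubalgebraOfPolars [MulLeftMono H] :
    IsBooleanSubalgebraOfPolars (principalPolars H) where
  subset := by
    rintro _ ⟨x, rfl⟩
    exact ⟨_, rfl⟩
  top_mem := hD.mem_principalPolars.2 ⟨⊤, by simp⟩
  bot_mem := hD.mem_principalPolars.2 ⟨⊥, by ext z; simp [hD.eq_bot_iff]⟩
  inf_mem S hS T hT := by
    obtain ⟨b, rfl⟩ := hD.mem_principalPolars.1 hS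
    obtain ⟨c, rfl⟩ := hD.mem_principalPolars.1 hT
    exact hD.mem_principalPolars.2 ⟨b ⊓ c, by ext z; simp⟩
  sup_mem S hS T hT := by
    obtain ⟨b, rfl⟩ := hD.mem_principalPolars.1 hS
    obtain ⟨c, rfl⟩ := hD.mem_principalPolars.1 hT
    refine hD.mem_principalPolars.2 ⟨b ⊔ c, ?_⟩
    have h : polar ({z | D z ≤ b} ∪ {z | D z ≤ c}) = polar {z | D z ≤ b} ∩ polar {z | D z ≤ c} := by
      ext y
      simp only [hD.mem_polar, Set.mem_union, or_imp, forall_and, Set.mem_inter_iff]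
    rw [h, hD.polar_setOf_le, hD.polar_setOf_le, ← Set.ofPred_and]
    simp only [← le_inf_iff]
    rw [hD.polar_setOf_le, compl_inf, compl_compl, compl_compl]
  compl_mem T hT := by
    obtain ⟨b, rfl⟩ := hD.mem_principalPolars.1 hT
    exact hD.mem_principalPolars.2 ⟨bᶜ, hD.polar_setOf_le b⟩

/-- A support map identifies its codomain with the algebra of principal polars. -/
theorem nonempty_orderIso : Nonempty (B ≃o principalPolars H) := by
  let f : B ↪o principalPolars H := OrderEmbedding.ofMapLEIff
    (fun b => ⟨{z | D z ≤ b}, hD.mem_principalPolars.2 ⟨b, rfl⟩⟩) (by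
      intro b c
      refine ⟨fun h => ?_, fun h z hz => le_trans hz h⟩
      obtain ⟨x, rfl⟩ := hD.surj b
      exact h (show x ∈ {z | D z ≤ D x} from le_rfl))
  refine ⟨RelIso.ofSurjective f ?_⟩
  rintro ⟨T, hT⟩
  obtain ⟨b, rfl⟩ := hD.mem_principalPolars.1 hT
  exact ⟨b, rfl⟩

end IsSupportMap

end Support

/-! ### Stone duality -/

section Stone

open TopologicalSpace

variable {X D : Type*} [TopologicalSpace X] [Preorder D] (e : Clopens X ≃o D)

/-- The prime ideal of the elements whose clopen set omits the point `x`. -/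
def pointIdeal (x : X) : StoneDual D where
  val :=
    { carrier := {a | x ∉ e.symm a}
      lower' := fun a b hab ha hb => ha (e.symm.monotone hab hb)
      nonempty' := ⟨e ⊥, fun h => by rw [e.symm_apply_apply] at h; exact h⟩
      directed' := fun a ha b hb => ⟨e (e.symm a ⊔ e.symm b), fun h => by
          rw [e.symm_apply_apply] at h
          exact h.elim ha hb,
        e.symm_apply_le.1 le_sup_left, e.symm_apply_le.1 le_sup_right⟩ }
  property :=
    { ne_univ := fun h => (Set.eq_univ_iff_forall.1 h (e ⊤)) (by
        rw [e.symm_apply_apply]; exact Set.mem_univ x)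
      compl_filter := .of_def
        ⟨e ⊤, fun h => h (by rw [e.symm_apply_apply]; exact Set.mem_univ x)⟩
        (fun a ha b hb => ⟨e (e.symm a ⊓ e.symm b), fun h => h (by
            rw [e.symm_apply_apply]
            exact ⟨not_not.1 ha, not_not.1 hb⟩),
          e.le_symm_apply.1 inf_le_left, e.le_symm_apply.1 inf_le_right⟩)
        (fun hab ha hb => hb (e.symm.monotone hab (not_not.1 ha))) }

theorem mem_pointIdeal {x : X} {a : D} : a ∈ (pointIdeal e x).1 ↔ x ∉ e.symm a := Iff.rfl

theorem pointIdeal_injective [CompactSpace X] [T2Space X] [TotallyDisconnectedSpace X] :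
    Function.Injective (pointIdeal e) := by
  intro x y hxy
  by_contra hne
  obtain ⟨U, hU, hxU, hyU⟩ := exists_isClopen_of_totally_separated hne
  have h : e ⟨U, hU⟩ ∈ (pointIdeal e y).1 := by
    rw [mem_pointIdeal, e.symm_apply_apply]
    exact hyU
  rw [← hxy, mem_pointIdeal, e.symm_apply_apply] at h
  exact h hxU

theorem pointIdeal_surjective [CompactSpace X] : Function.Surjective (pointIdeal e) := by
  rintro ⟨I, hI⟩
  have hlow : ∀ {a b}, a ≤ b → b ∈ I → a ∈ I := fun h hb => I.lower h hb
  let F := hI.compl_filter.toPFilter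
  have hne : Nonempty {a // a ∉ I} := F.nonempty.to_subtype
  -- The complement of a prime ideal is a filter, so its clopen sets are directed downwards; they
  -- are nonempty because I is a lower set. Compactness gives a common point.
  obtain ⟨x, hx⟩ := IsCompact.nonempty_iInter_of_directed_nonempty_isCompact_isClosed
    (fun a : {a // a ∉ I} => (e.symm a.1 : Set X))
    (by
      rintro ⟨a, ha⟩ ⟨b, hb⟩
      obtain ⟨c, hc, hca, hcb⟩ := F.directed a ha b hb
      exact ⟨⟨c, hc⟩, e.symm.monotone hca, e.symm.monotone hcb⟩)
    (by
      rintro ⟨a, ha⟩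
      rw [Set.nonempty_iff_ne_empty]
      intro h
      obtain ⟨b, hb⟩ := I.nonempty
      refine ha (hlow ?_ hb)
      rw [← e.symm.le_iff_le]
      exact fun y hy => absurd hy (Set.eq_empty_iff_forall_notMem.1 h y))
    (fun a => (e.symm a.1).isClopen.isClosed.isCompact)
    (fun a => (e.symm a.1).isClopen.isClosed)
  rw [Set.mem_iInter] at hx
  refine ⟨x, Subtype.ext (Order.Ideal.ext (Set.ext fun a => ⟨fun ha => ?_, fun ha => ?_⟩))⟩
  · by_contra haI
    exact ha (hx ⟨a, haI⟩)
  · intro hxa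
    -- A proper ideal cannot contain both a and its complement; if the complement is outside I, its
    -- clopen set contains x as well.
    by_cases hc : e (e.symm a)ᶜ ∈ I
    · obtain ⟨c, hcI, hac, hac'⟩ := I.directed a ha _ hc
      refine hI.toIsProper.ne_univ (Set.eq_univ_of_forall fun d => hlow ?_ hcI)
      rw [← e.symm.le_iff_le]
      have h1 : e.symm a ≤ e.symm c := e.symm.monotone hac
      have h2 : (e.symm a)ᶜ ≤ e.symm c := by simpa using e.symm.monotone hac'
      exact le_top.trans (sup_compl_eq_top.ge.trans (sup_le h1 h2))
    · have := hx ⟨_, hc⟩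
      simp only [e.symm_apply_apply] at this
      exact this hxa

include e in
/-- A Stone space is homeomorphic to the Stone dual of its algebra of clopen sets. -/
theorem nonempty_homeomorph_stoneDual [CompactSpace X] [T2Space X] [TotallyDisconnectedSpace X] :
    Nonempty (X ≃ₜ StoneDual D) := by
  let E : X ≃ StoneDual D :=
    Equiv.ofBijective (pointIdeal e) ⟨pointIdeal_injective e, pointIdeal_surjective e⟩
  refine ⟨E.toHomeomorphOfContinuousOpen (continuous_generateFrom_iff.2 ?_) ?_⟩
  · rintro _ ⟨a, rfl⟩
    convert (e.symm a).isClopen.isOpen using 1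
    ext x
    exact not_not
  · have hb : IsTopologicalBasis {s : Set X | IsClopen s} := isTopologicalBasis_isClopen
    rw [hb.isOpenMap_iff]
    intro U hU
    refine isOpen_generateFrom_of_mem ⟨e ⟨U, hU⟩, ?_⟩
    ext I
    obtain ⟨x, rfl⟩ := E.surjective I
    rw [E.injective.mem_set_image]
    change ¬ e ⟨U, hU⟩ ∈ (pointIdeal e x).1 ↔ _
    rw [mem_pointIdeal, not_not, e.symm_apply_apply]
    rfl

end Stone

/-! ### The action of the free `ℓ`-group on the chain of a right pre-order -/

section Action

variable {G : Type u} [Group G] [PartialOrder G]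

theorem isLHom_lClosure_subtype {K : Type*} [Group K] [Lattice K] (S : Set K) :
    IsLHom (lClosure S).subtype := ⟨fun _ _ => rfl, fun _ _ => rfl⟩

namespace PreCone

variable (C : PreCone G)

/-- The right regular representation with values in `H_C`. -/
noncomputable def toH : G →* C.H :=
  C.R.codRestrict _ fun a => by
    simp only [lClosure, Subgroup.mem_sInf]
    exact fun L hL => hL.1 ⟨a, rfl⟩

@[simp] theorem coe_toH (a : G) : (C.toH a : Aut C.Omega) = C.R a := rfl

theorem R_monotone [MulLeftMono G] [MulRightMono G] : Monotone C.R := by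
  intro a b hab x
  obtain ⟨c, rfl⟩ := C.cls_surjective x
  change C.cls (c * a) ≤ C.cls (c * b)
  rw [cls_le_cls]
  refine C.mem_of_one_le ?_
  rw [le_mul_inv_iff_mul_le, one_mul]
  exact mul_le_mul_right hab c

theorem toH_monotone [MulLeftMono G] [MulRightMono G] : Monotone C.toH := fun _ _ h => C.R_monotone h

theorem coe_eval_toH (t : Term G) : ((t.eval C.toH : C.H) : Aut C.Omega) = t.eval C.R :=
  Term.map_eval (isLHom_lClosure_subtype (Set.range C.R)) C.toH t

variable {V : LGroupClass.{u}} [MulLeftMono G] [MulRightMono G] {C}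

/-- The action of `F_V(G)` on `Ω_C` for a `V`-right pre-order `C`. -/
noncomputable def act (hC : C ∈ rightPreorders V G) : Free V G →* Aut C.Omega :=
  (lClosure (Set.range C.R)).subtype.comp
    ⟨⟨Free.ev hC C.toH C.toH_monotone, Free.ev_one hC C.toH C.toH_monotone⟩,
      Free.ev_mul hC C.toH C.toH_monotone⟩

theorem act_mk (hC : C ∈ rightPreorders V G) (t : Term G) :
    act hC (Free.mk t) = t.eval C.R := C.coe_eval_toH t

theorem act_eta (hC : C ∈ rightPreorders V G) (a : G) : act hC (eta V a) = C.R a := rfl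

theorem isLHom_act (hC : C ∈ rightPreorders V G) : IsLHom (act hC) :=
  ⟨fun x y => congrArg Subtype.val (Free.ev_sup hC C.toH C.toH_monotone x y),
    fun x y => congrArg Subtype.val (Free.ev_inf hC C.toH C.toH_monotone x y)⟩

/-- The action of F_V(G) preserves the order, so η(a) ≥ 1 moves [1] weakly upwards. This bounds
every V-right pre-order from below. -/
theorem mem_of_one_le_eta (hC : C ∈ rightPreorders V G) {a : G} (ha : 1 ≤ eta V a) : a ∈ C := by
  have h : act hC 1 ≤ act hC (eta V a) := by
    rw [← sup_eq_right, ← (isLHom_act hC).1, sup_eq_right.2 ha]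
  rw [map_one, act_eta] at h
  simpa [cls_one_le] using h (C.cls 1)

/-- x⁻¹ moves a point up exactly when x moves it down, so x ⊔ x⁻¹ moves up precisely the points not
fixed by x. -/
theorem act_mabs_apply (hC : C ∈ rightPreorders V G) (x : Free V G) (ω : C.Omega) :
    ω < act hC |x|ₘ ω ↔ act hC x ω ≠ ω := by
  rw [mabs, (isLHom_act hC).1, Aut.sup_apply, lt_max_iff]
  have h : ω < act hC x⁻¹ ω ↔ act hC x ω < ω := by
    rw [map_inv, ← not_le, ← not_le, ← Aut.le_iff_le (act hC x), Aut.apply_inv]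
  rw [h, ne_iff_lt_or_gt, or_comm]

theorem le_act_mabs_apply (hC : C ∈ rightPreorders V G) (x : Free V G) (ω : C.Omega) :
    ω ≤ act hC |x|ₘ ω := by
  by_cases h : act hC x ω = ω
  · rw [mabs, (isLHom_act hC).1, Aut.sup_apply]
    exact le_max_of_le_left h.ge
  · exact ((act_mabs_apply hC x ω).2 h).le

end PreCone

/-! ### Candidates for minimal right pre-orders -/

namespace PreCone

/-- The cone is closed under conjugation. -/
def IsNormal (C : PreCone G) : Prop := ∀ a ∈ C, ∀ b : G, b * a * b⁻¹ ∈ C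

end PreCone

/-- The right pre-orders that contain the kernel of `η` and, if `Q` holds, are normal. -/
def kernelPreorders (V : LGroupClass.{u}) (Q : Prop) (G : Type u) [Group G] [PartialOrder G] :
    Set (PreCone G) :=
  {C | (∀ a, eta V a = 1 → a ∈ C) ∧ (Q → C.IsNormal)}

/-- The members of `kernelPreorders` whose equivalence classes are those of the kernel of `η`. -/
def kernelOrders (V : LGroupClass.{u}) (Q : Prop) (G : Type u) [Group G] [PartialOrder G] :
    Set (PreCone G) :=
  {C | C ∈ kernelPreorders V Q G ∧ ∀ a, a ∈ C → a⁻¹ ∈ C → eta V a = 1}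

/-- The facts about a variety `V` on which the description of the minimal layer rests. -/
structure IsTame (V : LGroupClass.{u}) (Q : Prop) (G : Type u) [Group G] [PartialOrder G] :
    Prop where
  sep : ∀ t : Term G, (Free.mk t : Free V G) ≠ 1 →
    ∃ C ∈ kernelPreorders V Q G, t.eval C.R (C.cls 1) ≠ C.cls 1
  exists_le : ∀ C ∈ rightPreorders V G, ∃ D ∈ kernelPreorders V Q G, D ≤ C
  subset : kernelPreorders V Q G ⊆ rightPreorders V G

section

variable {V : LGroupClass.{u}} {Q : Prop}

/-- The right pre-order `C`, refined by `D` on the elements equivalent to `1`. -/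
def PreCone.refine (C D : PreCone G) : PreCone G where
  carrier := {a | a ∈ C ∧ (a⁻¹ ∈ C → a ∈ D)}
  one_mem' := ⟨C.one_mem, fun _ => D.one_mem⟩
  mul_mem' := by
    rintro a b ⟨ha, ha'⟩ ⟨hb, hb'⟩
    -- If (a * b)⁻¹ ∈ C, then a⁻¹ = b * (a * b)⁻¹ and b⁻¹ = (a * b)⁻¹ * a are in C, so D decides
    -- both factors.
    refine ⟨C.mul_mem ha hb, fun h => D.mul_mem (ha' ?_) (hb' ?_)⟩
    · simpa using C.mul_mem hb h
    · simpa using C.mul_mem h ha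
  pos_mem' a ha := ⟨C.mem_of_one_le ha, fun _ => D.mem_of_one_le ha⟩
  total' a := by
    change (a ∈ C ∧ (a⁻¹ ∈ C → a ∈ D)) ∨ (a⁻¹ ∈ C ∧ (a⁻¹⁻¹ ∈ C → a⁻¹ ∈ D))
    rw [inv_inv]
    have := C.total a
    have := D.total a
    tauto
  proper' := by
    obtain ⟨a, ha⟩ := C.proper'
    exact ⟨a, fun h => ha h.1⟩

theorem PreCone.IsNormal.conj_inv_mem {C : PreCone G} (h : C.IsNormal) {a b : G}
    (hab : (b * a * b⁻¹)⁻¹ ∈ C) : a⁻¹ ∈ C := by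
  have := h _ hab b⁻¹
  group at this
  simpa using this

theorem refine_mem_kernelPreorders {C D : PreCone G} (hC : C ∈ kernelPreorders V Q G)
    (hD : D ∈ kernelPreorders V Q G) : C.refine D ∈ kernelPreorders V Q G :=
  ⟨fun a ha => ⟨hC.1 a ha, fun _ => hD.1 a ha⟩, fun hQ a ha b =>
    ⟨hC.2 hQ a ha.1 b, fun h => hD.2 hQ a (ha.2 ((hC.2 hQ).conj_inv_mem h)) b⟩⟩

/-- The intersection of a chain of right pre-orders. -/
theorem exists_lowerBound_of_isChain {c : Set (PreCone G)} (hc : c ⊆ kernelPreorders V Q G)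
    (hchain : IsChain (· ≤ ·) c) (hne : c.Nonempty) :
    ∃ D ∈ kernelPreorders V Q G, ∀ C ∈ c, D ≤ C := by
  let D : PreCone G :=
    { carrier := {a | ∀ C ∈ c, a ∈ C}
      one_mem' := fun C _ => C.one_mem
      mul_mem' := fun ha hb C hC => C.mul_mem (ha C hC) (hb C hC)
      pos_mem' := fun a ha C _ => C.mem_of_one_le ha
      total' := fun a => by
        by_contra! h
        simp only [Set.mem_ofPred_eq, not_forall] at h
        obtain ⟨⟨C, hC, haC⟩, C', hC', haC'⟩ := h
        rcases hchain.total hC hC' with hle | hle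
        · exact haC' (hle (C.inv_mem_of_notMem haC))
        · exact haC (hle ((C'.total a).resolve_right haC'))
      proper' := by
        obtain ⟨C, hC⟩ := hne
        obtain ⟨a, ha⟩ := C.proper'
        exact ⟨a, fun h => ha (h C hC)⟩ }
  exact ⟨D, ⟨fun a ha C hC => (hc hC).1 a ha, fun hQ a ha b C hC => (hc hC).2 hQ a (ha C hC) b⟩,
    fun C hC a ha => ha C hC⟩

namespace IsTame

/-- A minimal kernel pre-order has no ties outside ker η: refining it by a kernel pre-order that
separates such a tie from 1 would give a strictly smaller one. -/
theorem exists_kernelOrder_le (hV : IsTame V Q G) {C : PreCone G}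
    (hC : C ∈ kernelPreorders V Q G) : ∃ D ∈ kernelOrders V Q G, D ≤ C := by
  obtain ⟨D, hDC, hD⟩ : ∃ D : PreCone G, D ≤ C ∧ Minimal (· ∈ kernelPreorders V Q G) D := by
    obtain ⟨D, hDC, hD⟩ := zorn_le_nonempty₀ (α := (PreCone G)ᵒᵈ) (kernelPreorders V Q G)
      (fun c hc hchain y hy => exists_lowerBound_of_isChain hc hchain.symm ⟨y, hy⟩) C hC
    exact ⟨D, hDC, hD.prop, fun E hE h => hD.le_of_ge hE h⟩
  refine ⟨D, ⟨hD.prop, fun a ha ha' => ?_⟩, hDC⟩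
  by_contra hne
  obtain ⟨E, hE, haE⟩ := hV.sep (.of a) hne
  have haE' : ¬ (a ∈ E ∧ a⁻¹ ∈ E) := by
    rw [← E.cls_eq_one]
    simpa [Term.eval] using haE
  have hle : D ≤ D.refine E :=
    hD.2 (refine_mem_kernelPreorders hD.prop hE) fun b hb => hb.1
  exact haE' ⟨(hle ha).2 ha', (hle ha').2 (by rwa [inv_inv])⟩

/-- Minimality of a kernel order C: if D ⊆ C and a ∈ C is missing from D, then a⁻¹ ∈ D ⊆ C, so η(a)
= 1, which puts a into D. -/
theorem minimalLayer_eq [MulLeftMono G] [MulRightMono G] (hV : IsTame V Q G) :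
    minimalLayer V G = kernelOrders V Q G := by
  ext C
  constructor
  · intro hC
    obtain ⟨D, hD, hDC⟩ := hV.exists_le C hC.prop
    obtain ⟨E, hE, hED⟩ := hV.exists_kernelOrder_le hD
    rwa [← hC.eq_of_le (hV.subset hE.1) (hED.trans hDC)]
  · intro hC
    refine ⟨hV.subset hC.1, fun D hD hDC a ha => ?_⟩
    by_contra haD
    have h1 := D.inv_mem_of_notMem haD
    exact haD (D.mem_of_one_le_eta hD (hC.2 a ha (hDC h1)).ge)

/-- For C ⊆ D the map Ω_C → Ω_D is monotone and equivariant, so a term that moves [1] in Ω_D also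
moves it in Ω_C. -/
theorem exists_kernelOrder_act_ne (hV : IsTame V Q G) {t : Term G}
    (ht : (Free.mk t : Free V G) ≠ 1) :
    ∃ C ∈ kernelOrders V Q G, t.eval C.R (C.cls 1) ≠ C.cls 1 := by
  obtain ⟨D, hD, hDt⟩ := hV.sep t ht
  obtain ⟨C, hC, hCD⟩ := hV.exists_kernelOrder_le hD
  refine ⟨C, hC, fun h => hDt ?_⟩
  have := Term.eval_equivariant (C.omegaMap_monotone D (MonoidHom.id G) hCD) (ρ := C.R) (ρ' := D.R)
    (fun a x => by
      obtain ⟨b, rfl⟩ := C.cls_surjective x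
      rfl) t (C.cls 1)
  rw [h] at this
  exact this.symm

end IsTame

end

end Action

/-! ### The three varieties are tame -/

section Tame

variable {G : Type u} [Group G] [PartialOrder G]

theorem exists_eval_ne_one {V : LGroupClass.{u}} {t : Term G} (ht : (Free.mk t : Free V G) ≠ 1) :
    ∃ (H : Type u) (_ : Group H) (_ : Lattice H) (_ : MulLeftMono H) (_ : MulRightMono H)
      (_ : V H) (p : G →* H), Monotone p ∧ t.eval p ≠ 1 := by
  by_contra! h
  exact ht (Free.ext fun H _ _ _ _ hV p hp => h H _ _ _ _ hV p hp)

theorem map_eq_one_of_eta_eq_one {V : LGroupClass.{u}} {H : Type u} [Group H] [Lattice H]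
    [MulLeftMono H] [MulRightMono H] (hV : V H) {p : G →* H} (hp : Monotone p) {a : G}
    (ha : eta V a = 1) : p a = 1 :=
  congrArg (Free.ev hV p hp) ha

/-- A lattice pre-cone of an `ℓ`-group pulls back along a positive homomorphism. -/
theorem exists_comap_eval_ne {H : Type u} [Group H] [Lattice H] [MulLeftMono H] [MulRightMono H]
    {p : G →* H} (hp : Monotone p) {D : PreCone H} (hD : ∀ a ∈ D, a ⊓ 1 ∈ D) {t : Term G}
    (ht : D.cls (t.eval p) ≠ D.cls 1) :
    ∃ C : PreCone G, (∀ a, a ∈ C ↔ p a ∈ D) ∧ t.eval C.R (C.cls 1) ≠ C.cls 1 := by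
  have heval : t.eval (fun a => D.R (p a)) (D.cls 1) = D.cls (t.eval p) := by
    rw [← Term.map_eval (PreCone.isLHom_R hD), PreCone.R_apply_cls, one_mul]
  have hproper : ∃ a, p a ∉ D := by
    by_contra! h
    -- If p[G] were inside D, every p a would fix [1]; mapping the one-point chain to [1] shows that
    -- every term value would fix it too.
    have := Term.eval_equivariant (π := fun _ : PUnit.{1} => D.cls 1) monotone_const
      (ρ := fun _ : G => 1) (ρ' := fun a => D.R (p a)) (fun a x => by
        simp only [PreCone.R_apply_cls, one_mul]
        refine (D.cls_eq_one.2 ⟨h a, ?_⟩).symm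
        rw [← map_inv]
        exact h a⁻¹) t PUnit.unit
    exact ht (heval.symm.trans this.symm)
  obtain ⟨C, hC⟩ : ∃ C : PreCone G, ∀ a, a ∈ C ↔ p a ∈ D :=
    ⟨PreCone.comap p hp D hproper, fun _ => Iff.rfl⟩
  refine ⟨C, hC, fun h => ht ?_⟩
  have := Term.eval_equivariant (C.omegaMap_monotone D p fun a ha => (hC a).1 ha)
    (ρ := C.R) (ρ' := fun a => D.R (p a)) (fun a x => by
      obtain ⟨b, rfl⟩ := C.cls_surjective x
      simp) t (C.cls 1)
  rw [h, PreCone.omegaMap_cls, map_one, heval] at this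
  exact this.symm

namespace PreCone

variable {C : PreCone G}

theorem IsNormal.R_le_R (hC : C.IsNormal) {a b : G} (h : b * a⁻¹ ∈ C) : C.R a ≤ C.R b := by
  intro x
  obtain ⟨c, rfl⟩ := C.cls_surjective x
  change C.cls (c * a) ≤ C.cls (c * b)
  rw [cls_le_cls]
  simpa [mul_assoc] using hC _ h c

theorem IsNormal.R_total (hC : C.IsNormal) (a b : G) : C.R a ≤ C.R b ∨ C.R b ≤ C.R a := by
  rcases C.total (b * a⁻¹) with h | h
  · exact Or.inl (hC.R_le_R h)
  · exact Or.inr (hC.R_le_R (by simpa using h))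

/-- For normal C the image of R is totally ordered, so it is already closed under joins and meets.
-/
theorem IsNormal.exists_R_eq (hC : C.IsNormal) {f : Aut C.Omega}
    (hf : f ∈ lClosure (Set.range C.R)) : ∃ a, C.R a = f := by
  simp only [lClosure, Subgroup.mem_sInf] at hf
  refine hf C.R.range ⟨?_, ?_, ?_⟩
  · rintro _ ⟨a, rfl⟩
    exact ⟨a, rfl⟩
  · rintro _ ⟨a, rfl⟩ _ ⟨b, rfl⟩
    rcases hC.R_total a b with h | h
    · exact ⟨b, (sup_eq_right.2 h).symm⟩
    · exact ⟨a, (sup_eq_left.2 h).symm⟩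
  · rintro _ ⟨a, rfl⟩ _ ⟨b, rfl⟩
    rcases hC.R_total a b with h | h
    · exact ⟨a, (inf_eq_left.2 h).symm⟩
    · exact ⟨b, (inf_eq_right.2 h).symm⟩

theorem IsNormal.H_total (hC : C.IsNormal) (f g : C.H) : f ≤ g ∨ g ≤ f := by
  obtain ⟨f, hf⟩ := f
  obtain ⟨g, hg⟩ := g
  obtain ⟨a, rfl⟩ := hC.exists_R_eq hf
  obtain ⟨b, rfl⟩ := hC.exists_R_eq hg
  exact hC.R_total a b

theorem IsNormal.representableLGroups_H (hC : C.IsNormal) : representableLGroups C.H := by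
  classical
  let L : LinearOrder C.H :=
    @Lattice.toLinearOrder _ _ _ (Classical.decRel _) (Classical.decRel _) ⟨hC.H_total⟩
  exact ⟨PUnit, fun _ => C.H, fun _ => inferInstance, fun _ => L,
    fun _ => (inferInstance : MulLeftMono C.H), fun _ => (inferInstance : MulRightMono C.H),
    fun _ => MonoidHom.id _, fun _ => ⟨fun _ _ => rfl, fun _ _ => rfl⟩,
    fun _ => Function.surjective_id, fun x y h => h PUnit.unit⟩

end PreCone

variable [MulLeftMono G] [MulRightMono G]

theorem isTame_allLGroups : IsTame allLGroups.{u} False G where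
  sep t ht := by
    obtain ⟨H, _, _, _, _, hV, p, hp, hne⟩ := exists_eval_ne_one ht
    obtain ⟨D, hD, hDt⟩ := exists_preCone_cls_ne hne
    obtain ⟨C, hC, hCt⟩ := exists_comap_eval_ne hp hD hDt
    refine ⟨C, ⟨fun a ha => (hC a).2 ?_, False.elim⟩, hCt⟩
    rw [map_eq_one_of_eta_eq_one hV hp ha]
    exact D.one_mem
  exists_le C hC := ⟨C, ⟨fun a ha => C.mem_of_one_le_eta hC ha.ge, False.elim⟩, le_rfl⟩
  subset _ _ := trivial

/-- Commutators lie in ker η, which makes V-right pre-orders normal and, conversely, makes H_C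
commutative. -/
theorem isTame_abelianLGroups : IsTame abelianLGroups.{u} True G where
  sep t ht := by
    obtain ⟨H, _, _, _, _, hV, p, hp, hne⟩ := exists_eval_ne_one ht
    obtain ⟨D, hD, hDt⟩ := exists_preCone_cls_ne hne
    obtain ⟨C, hC, hCt⟩ := exists_comap_eval_ne hp hD hDt
    refine ⟨C, ⟨fun a ha => (hC a).2 ?_, fun _ a ha b => (hC _).2 ?_⟩, hCt⟩
    · rw [map_eq_one_of_eta_eq_one hV hp ha]
      exact D.one_mem
    · rw [map_mul, map_mul, hV (p b), map_inv, mul_inv_cancel_right]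
      exact (hC a).1 ha
  exists_le C hC := by
    refine ⟨C, ⟨fun a ha => C.mem_of_one_le_eta hC ha.ge, fun _ a ha b => ?_⟩, le_rfl⟩
    have h : b * a * b⁻¹ * a⁻¹ ∈ C := C.mem_of_one_le_eta hC (by
      rw [map_mul, map_mul, map_mul, free_abelian_mem (eta abelianLGroups b), map_inv, map_inv,
        mul_inv_cancel_right, mul_inv_cancel])
    simpa using C.mul_mem h ha
  subset C hC f g := by
    obtain ⟨f, hf⟩ := f
    obtain ⟨g, hg⟩ := g
    obtain ⟨a, rfl⟩ := (hC.2 trivial).exists_R_eq hf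
    obtain ⟨b, rfl⟩ := (hC.2 trivial).exists_R_eq hg
    refine Subtype.ext (Aut.ext fun x => ?_)
    obtain ⟨c, rfl⟩ := C.cls_surjective x
    have key : ∀ a b : G, c * a * b * (c * b * a)⁻¹ ∈ C := fun a b => hC.1 _ (by
      simp only [map_mul, map_inv]
      rw [mul_assoc (eta abelianLGroups c), free_abelian_mem (eta abelianLGroups a), ← mul_assoc,
        mul_inv_cancel])
    exact C.cls_eq_cls.2 ⟨key _ _, key _ _⟩

theorem isTame_representableLGroups : IsTame representableLGroups.{u} True G where
  sep t ht := by
    obtain ⟨H, _, _, _, _, hV, p, hp, hne⟩ := exists_eval_ne_one ht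
    obtain ⟨ι, L, _, _, _, _, f, hf, -, hinj⟩ := id hV
    obtain ⟨i, hi⟩ : ∃ i, f i (t.eval p) ≠ 1 := by
      by_contra! h
      exact hne (hinj _ _ fun i => by rw [h i, map_one])
    have hmono : Monotone (f i) := fun a b hab => by
      rw [← sup_eq_right, ← (hf i).1, sup_eq_right.2 hab]
    -- The cone of a factor in which the term is nontrivial; its pullback is normal because the
    -- factor is an ordered group.
    let D : PreCone H :=
      { carrier := {h | 1 ≤ f i h}
        one_mem' := by simp
        mul_mem' := fun {a b} ha hb => by
          change 1 ≤ f i (a * b)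
          rw [map_mul]
          exact one_le_mul ha hb
        pos_mem' := fun a ha => by simpa using hmono ha
        total' := fun a => by
          change 1 ≤ f i a ∨ 1 ≤ f i a⁻¹
          rw [map_inv, one_le_inv']
          exact le_total _ _
        proper' := by
          by_contra! h
          refine hi (le_antisymm ?_ (h (t.eval p)))
          have := h (t.eval p)⁻¹
          change 1 ≤ f i (t.eval p)⁻¹ at this
          rwa [map_inv, one_le_inv'] at this }
    have hD : ∀ a ∈ D, a ⊓ 1 ∈ D := fun a ha => by
      change 1 ≤ f i (a ⊓ 1)
      rw [(hf i).2, map_one]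
      exact le_inf ha le_rfl
    have hDt : D.cls (t.eval p) ≠ D.cls 1 := fun h => by
      obtain ⟨h1, h2⟩ := D.cls_eq_one.1 h
      change 1 ≤ f i (t.eval p)⁻¹ at h2
      rw [map_inv, one_le_inv'] at h2
      exact hi (le_antisymm h2 h1)
    obtain ⟨C, hC, hCt⟩ := exists_comap_eval_ne hp hD hDt
    refine ⟨C, ⟨fun a ha => (hC a).2 ?_, fun _ a ha b => (hC _).2 ?_⟩, hCt⟩
    · rw [map_eq_one_of_eta_eq_one hV hp ha]
      exact D.one_mem
    · have h1 : 1 ≤ f i (p a) := (hC a).1 ha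
      change 1 ≤ f i (p (b * a * b⁻¹))
      simp only [map_mul, map_inv]
      rwa [le_mul_inv_iff_mul_le, one_mul, le_mul_iff_one_le_right']
  exists_le C hC := by
    obtain ⟨ι, L, _, _, _, _, f, hf, -, hinj⟩ := id hC
    have hmono : ∀ i, Monotone (f i) := fun i a b hab => by
      rw [← sup_eq_right, ← (hf i).1, sup_eq_right.2 hab]
    -- F is generated by the sets {i | 1 < f i h} for h moving [1] strictly up. It is proper: if
    -- such a set were empty, then h ≤ 1 in every factor, hence in H_C.
    let F : Filter ι :=
      { sets := {s | ∃ h : C.H, C.cls 1 < h.1 (C.cls 1) ∧ ∀ i, 1 < f i h → i ∈ s}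
        univ_sets := by
          obtain ⟨a, ha⟩ := C.proper'
          refine ⟨C.toH a⁻¹, ?_, fun _ _ => Set.mem_univ _⟩
          rw [PreCone.coe_toH, PreCone.R_apply_cls, one_mul, ← not_le, C.cls_le_one, inv_inv]
          exact ha
        sets_of_superset := fun ⟨h, h1, h2⟩ hst => ⟨h, h1, fun i hi => hst (h2 i hi)⟩
        inter_sets := fun ⟨h, h1, h2⟩ ⟨k, k1, k2⟩ => by
          refine ⟨h ⊓ k, lt_min h1 k1, fun i hi => ?_⟩
          rw [(hf i).2, lt_inf_iff] at hi
          exact ⟨h2 i hi.1, k2 i hi.2⟩ }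
    have hF : F.NeBot := by
      refine ⟨fun hbot => ?_⟩
      obtain ⟨h, h1, h2⟩ := (Filter.empty_mem_iff_bot.2 hbot : ∅ ∈ F)
      have h3 : h ⊔ 1 = 1 := hinj _ _ fun i => by
        rw [(hf i).1, map_one]
        exact sup_eq_right.2 (not_lt.1 (h2 i))
      have h4 : h ≤ 1 := h3 ▸ le_sup_left
      exact not_le.2 h1 (h4 (C.cls 1))
    let U := Ultrafilter.of F
    have hU : ∀ a ∉ C, ∀ᶠ i in (U : Filter ι), 1 < f i (C.toH a⁻¹) := fun a ha =>
      Ultrafilter.of_le F ⟨C.toH a⁻¹, by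
        rw [PreCone.coe_toH, PreCone.R_apply_cls, one_mul, ← not_le, C.cls_le_one, inv_inv]
        exact ha, fun _ hi => hi⟩
    -- If a ∉ C, then a⁻¹ moves [1] strictly up, so a is strictly negative in U-almost all factors.
    -- Thus the cone of the ultraproduct order pulls back into C.
    have hUC : ∀ a, (∀ᶠ i in (U : Filter ι), 1 ≤ f i (C.toH a)) → a ∈ C := by
      intro a ha
      by_contra haC
      obtain ⟨i, h1, h2⟩ := (ha.and (hU a haC)).exists
      rw [map_inv, map_inv, one_lt_inv'] at h2
      exact not_le.2 h2 h1
    let D : PreCone G :=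
      { carrier := {a | ∀ᶠ i in (U : Filter ι), 1 ≤ f i (C.toH a)}
        one_mem' := by simp
        mul_mem' := fun {a b} ha hb => by
          filter_upwards [ha, hb] with i h1 h2
          rw [map_mul, map_mul]
          exact one_le_mul h1 h2
        pos_mem' := fun a ha => Filter.Eventually.of_forall fun i => by
          simpa using hmono i (C.toH_monotone ha)
        total' := fun a => by
          refine Ultrafilter.eventually_or.1 (Filter.Eventually.of_forall fun i => ?_)
          rw [map_inv, map_inv, one_le_inv']
          exact le_total _ _
        proper' := by
          obtain ⟨a, ha⟩ := C.proper'
          exact ⟨a, fun h => ha (hUC a h)⟩ }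
    refine ⟨D, ⟨fun a ha => Filter.Eventually.of_forall fun i => ?_, fun _ a ha b => ?_⟩, hUC⟩
    · rw [map_eq_one_of_eta_eq_one hC C.toH_monotone ha, map_one]
    · refine Filter.Eventually.mono ha fun i (hi : 1 ≤ f i (C.toH a)) => ?_
      simp only [map_mul, map_inv]
      rwa [le_mul_inv_iff_mul_le, one_mul, le_mul_iff_one_le_right']
  subset C hC := (hC.2 trivial).representableLGroups_H

end Tame

/-! ### The space of kernel orders -/

section KernelOrders

open TopologicalSpace Filter Topology

variable {G : Type u} [Group G] [PartialOrder G] {V : LGroupClass.{u}} {Q : Prop}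

/-- Equality of classes does not depend on the kernel order, so it transfers from one kernel order
to another. -/
theorem kernelOrders.cls_eq_cls {C : PreCone G} (hC : C ∈ kernelOrders V Q G) {a b : G} :
    C.cls a = C.cls b ↔ eta V a = eta V b := by
  have h : ∀ {a b : G}, eta V a = eta V b → b * a⁻¹ ∈ C := fun {a b} h =>
    hC.1.1 _ (by rw [map_mul, map_inv, h, mul_inv_cancel])
  rw [PreCone.cls_eq_cls]
  refine ⟨fun ⟨h1, h2⟩ => ?_, fun h' => ⟨h h', h h'.symm⟩⟩
  have := hC.2 _ h2 (by simpa using h1)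
  rwa [map_mul, map_inv, mul_inv_eq_one] at this

/-- The complement is ℙ(a⁻¹). The set itself is ℙ(a) if η(a) ≠ 1, and the whole space otherwise. -/
theorem kernelOrders.isClopen_mem (a : G) : IsClopen {C : kernelOrders V Q G | a ∈ C.1} := by
  have hopen : ∀ b : G, IsOpen {C : kernelOrders V Q G | C.1 ∈ PreCone.P b} := fun b =>
    (isOpen_generateFrom_of_mem ⟨b, rfl⟩ : IsOpen (PreCone.P b)).preimage continuous_subtype_val
  constructor
  · rw [← isOpen_compl_iff]
    convert hopen a⁻¹ using 1
    ext C
    change a ∉ C.1 ↔ a⁻¹ ∈ C.1 ∧ a⁻¹⁻¹ ∉ C.1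
    rw [inv_inv]
    exact ⟨fun h => ⟨C.1.inv_mem_of_notMem h, h⟩, fun h => h.2⟩
  · by_cases ha : eta V a = 1
    · convert isOpen_univ
      exact Set.eq_univ_of_forall fun C => C.2.1.1 a ha
    · convert hopen a using 1
      ext C
      exact ⟨fun h => ⟨h, fun h' => ha (C.2.2 a h h')⟩, fun h => h.1⟩

theorem kernelOrders.exists_mem_notMem {C D : kernelOrders V Q G} (h : C ≠ D) :
    ∃ a, a ∈ C.1 ∧ a⁻¹ ∉ C.1 ∧ a ∉ D.1 := by
  by_contra! hcon
  have hCD : ∀ a ∈ C.1, a ∈ D.1 := fun a ha => by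
    by_cases ha' : a⁻¹ ∈ C.1
    · exact D.2.1.1 _ (C.2.2 a ha ha')
    · exact hcon a ha ha'
  refine h (Subtype.ext (PreCone.ext fun a => ⟨hCD a, fun ha => ?_⟩))
  by_contra haC
  have h1 := C.1.inv_mem_of_notMem haC
  exact haC (C.2.1.1 _ (D.2.2 a ha (hCD _ h1)))

instance : TotallySeparatedSpace (kernelOrders V Q G) :=
  totallySeparatedSpace_iff_exists_isClopen.2 fun C D h => by
    obtain ⟨a, ha, -, haD⟩ := kernelOrders.exists_mem_notMem h
    exact ⟨_, kernelOrders.isClopen_mem a, ha, haD⟩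

/-- The limit of an ultrafilter U consists of the elements lying in U-almost all cones. -/
instance : CompactSpace (kernelOrders V Q G) where
  isCompact_univ := by
    refine isCompact_iff_ultrafilter_le_nhds.2 fun U _ => ?_
    have hker : ∀ a, (∀ᶠ D in (U : Filter (kernelOrders V Q G)), a ∈ D.1) →
        (∀ᶠ D in (U : Filter (kernelOrders V Q G)), a⁻¹ ∈ D.1) → eta V a = 1 := fun a h1 h2 => by
      obtain ⟨D, h1, h2⟩ := (h1.and h2).exists
      exact D.2.2 a h1 h2
    let C : PreCone G :=
      { carrier := {a | ∀ᶠ D in (U : Filter (kernelOrders V Q G)), a ∈ D.1}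
        one_mem' := Eventually.of_forall fun D => D.1.one_mem
        mul_mem' := fun ha hb => (Eventually.and ha hb).mono fun D h => D.1.mul_mem h.1 h.2
        pos_mem' := fun a ha => Eventually.of_forall fun D => D.1.mem_of_one_le ha
        total' := fun a => Ultrafilter.eventually_or.1 (Eventually.of_forall fun D => D.1.total a)
        proper' := by
          -- If the limit were all of G, then η would be trivial and every D would equal G.
          obtain ⟨D⟩ := (U : Filter (kernelOrders V Q G)).nonempty_of_neBot
          obtain ⟨a, ha⟩ := D.1.proper'
          by_contra! h
          exact ha (D.2.1.1 a (hker a (h a) (h a⁻¹))) }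
    refine ⟨⟨C, ⟨fun a ha => Eventually.of_forall fun D => D.2.1.1 a ha, fun hQ a ha b =>
      Eventually.mono ha fun D h => D.2.1.2 hQ a h b⟩, hker⟩, trivial, ?_⟩
    rw [nhds_subtype, ← map_le_iff_le_comap]
    refine tendsto_nhds_generateFrom_iff.2 ?_
    rintro _ ⟨a, rfl⟩ ⟨h1, h2⟩
    exact Eventually.and h1 (Ultrafilter.eventually_not.2 h2)

theorem kernelOrders.isStoneSpace : IsStoneSpace (kernelOrders V Q G) :=
  ⟨inferInstance, inferInstance, inferInstance⟩

/-- The action of a term on the chains of kernel orders is locally constant. -/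
theorem kernelOrders.eventually_eval_eq (t : Term G) (C : kernelOrders V Q G) (b : G) :
    (∃ g, ∀ᶠ D in 𝓝 C, (t.eval D.1.R : Aut D.1.Omega) (D.1.cls b) = D.1.cls g) ∧
      ∃ g, ∀ᶠ D in 𝓝 C, (t.eval D.1.R : Aut D.1.Omega)⁻¹ (D.1.cls b) = D.1.cls g := by
  have hle : ∀ g h : G, C.1.cls g ≤ C.1.cls h → ∀ᶠ D in 𝓝 C, D.1.cls g ≤ D.1.cls h :=
    fun g h hgh => (isClopen_mem (h * g⁻¹)).isOpen.mem_nhds hgh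
  have hmax : ∀ g h : G, ∃ k, ∀ᶠ D in 𝓝 C, max (D.1.cls g) (D.1.cls h) = D.1.cls k := fun g h => by
    rcases le_total (C.1.cls g) (C.1.cls h) with hgh | hgh
    · exact ⟨h, (hle _ _ hgh).mono fun D => max_eq_right⟩
    · exact ⟨g, (hle _ _ hgh).mono fun D => max_eq_left⟩
  have hmin : ∀ g h : G, ∃ k, ∀ᶠ D in 𝓝 C, min (D.1.cls g) (D.1.cls h) = D.1.cls k := fun g h => by
    rcases le_total (C.1.cls g) (C.1.cls h) with hgh | hgh
    · exact ⟨g, (hle _ _ hgh).mono fun D => min_eq_left⟩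
    · exact ⟨h, (hle _ _ hgh).mono fun D => min_eq_right⟩
  -- The inverse is carried along for the case `inv`. For joins and meets, the comparison of two
  -- classes at C persists near C, since it is membership in a clopen set.
  induction t generalizing b with
  | of a =>
    refine ⟨⟨b * a, Eventually.of_forall fun D => rfl⟩,
      ⟨b * a⁻¹, Eventually.of_forall fun D => ?_⟩⟩
    change (D.1.R a)⁻¹ _ = _
    rw [← map_inv, PreCone.R_apply_cls]
  | one =>
    refine ⟨⟨b, Eventually.of_forall fun D => rfl⟩, ⟨b, Eventually.of_forall fun D => ?_⟩⟩
    change (1 : Aut D.1.Omega)⁻¹ _ = _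
    rw [inv_one, Aut.one_apply]
  | mul s t hs ht =>
    constructor
    · obtain ⟨g, hg⟩ := (hs b).1
      obtain ⟨h, hh⟩ := (ht g).1
      refine ⟨h, (hg.and hh).mono fun D hD => ?_⟩
      rw [Term.eval, Aut.mul_apply, hD.1, hD.2]
    · obtain ⟨g, hg⟩ := (ht b).2
      obtain ⟨h, hh⟩ := (hs g).2
      refine ⟨h, (hg.and hh).mono fun D hD => ?_⟩
      rw [Term.eval, mul_inv_rev, Aut.mul_apply, hD.1, hD.2]
  | inv t ht =>
    simp only [Term.eval, inv_inv]
    exact ⟨(ht b).2, (ht b).1⟩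
  | sup s t hs ht =>
    constructor
    · obtain ⟨g, hg⟩ := (hs b).1
      obtain ⟨h, hh⟩ := (ht b).1
      obtain ⟨k, hk⟩ := hmax g h
      refine ⟨k, (hg.and (hh.and hk)).mono fun D hD => ?_⟩
      rw [Term.eval, Aut.sup_apply, hD.1, hD.2.1, hD.2.2]
    · obtain ⟨g, hg⟩ := (hs b).2
      obtain ⟨h, hh⟩ := (ht b).2
      obtain ⟨k, hk⟩ := hmin g h
      refine ⟨k, (hg.and (hh.and hk)).mono fun D hD => ?_⟩
      rw [Term.eval, inv_sup, Aut.inf_apply, hD.1, hD.2.1, hD.2.2]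
  | inf s t hs ht =>
    constructor
    · obtain ⟨g, hg⟩ := (hs b).1
      obtain ⟨h, hh⟩ := (ht b).1
      obtain ⟨k, hk⟩ := hmin g h
      refine ⟨k, (hg.and (hh.and hk)).mono fun D hD => ?_⟩
      rw [Term.eval, Aut.inf_apply, hD.1, hD.2.1, hD.2.2]
    · obtain ⟨g, hg⟩ := (hs b).2
      obtain ⟨h, hh⟩ := (ht b).2
      obtain ⟨k, hk⟩ := hmax g h
      refine ⟨k, (hg.and (hh.and hk)).mono fun D hD => ?_⟩
      rw [Term.eval, inv_inf, Aut.sup_apply, hD.1, hD.2.1, hD.2.2]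

/-- Near C the term sends [1] to [g] with g fixed, and whether [g] = [1] depends only on η(g). -/
theorem kernelOrders.isClopen_eval_ne (t : Term G) :
    IsClopen {C : kernelOrders V Q G |
      (t.eval C.1.R : Aut C.1.Omega) (C.1.cls 1) ≠ C.1.cls 1} := by
  constructor
  · rw [← isOpen_compl_iff, isOpen_iff_eventually]
    intro C hC
    obtain ⟨g, hg⟩ := (eventually_eval_eq t C 1).1
    refine hg.mono fun D hD h => h ?_
    have hC' := not_not.1 hC
    rw [hg.self_of_nhds, cls_eq_cls C.2] at hC'
    rw [hD, cls_eq_cls D.2, hC']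
  · rw [isOpen_iff_eventually]
    intro C hC
    obtain ⟨g, hg⟩ := (eventually_eval_eq t C 1).1
    refine hg.mono fun D hD h => hC ?_
    rw [hD, cls_eq_cls D.2] at h
    rw [hg.self_of_nhds, cls_eq_cls C.2, h]

end KernelOrders

/-! ### Supports of the elements of the free ℓ-group. -/

section Support

open TopologicalSpace Filter Topology

variable {G : Type u} [Group G] [PartialOrder G] {V : LGroupClass.{u}} {Q : Prop}
variable [MulLeftMono G] [MulRightMono G]

namespace IsTame

/-- The clopen set of the kernel orders `C` for which `x` moves the class `[1]` of `Ω_C`. -/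
def support (hV : IsTame V Q G) (x : Free V G) : Clopens (kernelOrders V Q G) where
  carrier := {C | PreCone.act (hV.subset C.2.1) x (C.1.cls 1) ≠ C.1.cls 1}
  isClopen' := by
    induction x using Quotient.inductionOn with | _ t
    convert kernelOrders.isClopen_eval_ne t using 3 with C
    exact Iff.of_eq (congrArg (fun f : Aut C.1.Omega => f (C.1.cls 1) ≠ C.1.cls 1)
      (PreCone.act_mk (hV.subset C.2.1) t))

variable (hV : IsTame V Q G)

theorem mem_support {x : Free V G} {C : kernelOrders V Q G} :
    C ∈ hV.support x ↔ PreCone.act (hV.subset C.2.1) x (C.1.cls 1) ≠ C.1.cls 1 := Iff.rfl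

/-- Both absolute values move [1] weakly up, so their pointwise minimum moves it exactly when both
do. -/
theorem support_mabs_inf_mabs (x y : Free V G) :
    hV.support (|x|ₘ ⊓ |y|ₘ) = hV.support x ⊓ hV.support y := by
  ext C
  change _ ≠ _ ↔ _ ≠ _ ∧ _ ≠ _
  have hC := hV.subset C.2.1
  rw [← PreCone.act_mabs_apply hC x, ← PreCone.act_mabs_apply hC y, (PreCone.isLHom_act hC).2,
    Aut.inf_apply, ← lt_min_iff]
  exact (lt_iff_le_and_ne.trans ((and_iff_right (le_min (PreCone.le_act_mabs_apply hC x _)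
    (PreCone.le_act_mabs_apply hC y _))).trans ne_comm)).symm

theorem support_mabs_sup_mabs (x y : Free V G) :
    hV.support (|x|ₘ ⊔ |y|ₘ) = hV.support x ⊔ hV.support y := by
  ext C
  change _ ≠ _ ↔ _ ≠ _ ∨ _ ≠ _
  have hC := hV.subset C.2.1
  rw [← PreCone.act_mabs_apply hC x, ← PreCone.act_mabs_apply hC y, (PreCone.isLHom_act hC).1,
    Aut.sup_apply, ← lt_max_iff]
  exact (lt_iff_le_and_ne.trans ((and_iff_right (le_max_of_le_left
    (PreCone.le_act_mabs_apply hC x _))).trans ne_comm)).symm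

theorem support_eq_bot_iff {x : Free V G} : hV.support x = ⊥ ↔ x = 1 := by
  constructor
  · intro h
    induction x using Quotient.inductionOn with | _ t
    by_contra hne
    obtain ⟨C, hC, hCt⟩ := hV.exists_kernelOrder_act_ne hne
    have hmem : (⟨C, hC⟩ : kernelOrders V Q G) ∈ hV.support (Free.mk t) := by
      rw [mem_support, PreCone.act_mk]
      exact hCt
    exact (h ▸ hmem : (⟨C, hC⟩ : kernelOrders V Q G) ∈ (⊥ : Clopens _))
  · rintro rfl
    ext C
    change _ ≠ _ ↔ False
    rw [map_one, Aut.one_apply]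
    simp

/-- The subbasic sets ℙ(a) are themselves supports, which is what makes supports plentiful. -/
theorem mem_support_eta_sup_one {a : G} {C : kernelOrders V Q G} :
    C ∈ hV.support (eta V a ⊔ 1) ↔ a ∈ C.1 ∧ a⁻¹ ∉ C.1 := by
  have hC := hV.subset C.2.1
  rw [mem_support, (PreCone.isLHom_act hC).1, map_one, Aut.sup_apply, Aut.one_apply,
    PreCone.act_eta, PreCone.R_apply_cls, one_mul, Ne, max_eq_right_iff, C.1.cls_le_one]
  exact ⟨fun h => ⟨by simpa using C.1.inv_mem_of_notMem h, h⟩, fun h => h.2⟩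

/-- Two compactness arguments: finite meets give a support containing a given C ∈ U and avoiding the
complement of U, and finite joins of these cover U. -/
theorem support_surjective : Function.Surjective hV.support := by
  intro U
  have hsep : ∀ C ∈ U, ∃ x, C ∈ hV.support x ∧ hV.support x ≤ U := by
    intro C hC
    obtain ⟨x, hCx, hx⟩ : ∃ x, C ∈ hV.support x ∧
        Disjoint ((U : Set (kernelOrders V Q G))ᶜ) (hV.support x) := by
      refine U.isClopen.compl.isClosed.isCompact.induction_on
        (p := fun s => ∃ x, C ∈ hV.support x ∧ Disjoint s (hV.support x : Set _)) ?_ ?_ ?_ ?_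
      · obtain ⟨a, ha⟩ := C.1.proper'
        exact ⟨eta V a⁻¹ ⊔ 1, hV.mem_support_eta_sup_one.2
          ⟨C.1.inv_mem_of_notMem ha, by rwa [inv_inv]⟩, Set.empty_disjoint _⟩
      · rintro s t hst ⟨x, hx, htx⟩
        exact ⟨x, hx, htx.mono_left hst⟩
      · rintro s t ⟨x, hx, hsx⟩ ⟨y, hy, hty⟩
        refine ⟨|x|ₘ ⊓ |y|ₘ, ?_, ?_⟩
        · rw [support_mabs_inf_mabs]
          exact ⟨hx, hy⟩
        · rw [support_mabs_inf_mabs, Set.disjoint_union_left]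
          exact ⟨hsx.mono_right Set.inter_subset_left, hty.mono_right Set.inter_subset_right⟩
      · intro D hD
        obtain ⟨a, ha, ha', haD⟩ := kernelOrders.exists_mem_notMem
          (fun h : C = D => hD (h ▸ hC))
        refine ⟨((hV.support (eta V a ⊔ 1))ᶜ : Clopens _), mem_nhdsWithin_of_mem_nhds
          ((Clopens.isClopen _).isOpen.mem_nhds ?_), eta V a ⊔ 1,
          hV.mem_support_eta_sup_one.2 ⟨ha, ha'⟩, ?_⟩
        · exact fun h => haD (hV.mem_support_eta_sup_one.1 h).1
        · exact disjoint_compl_left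
    exact ⟨x, hCx, fun D hD => by_contra fun h => Set.disjoint_left.1 hx h hD⟩
  obtain ⟨x, hx, hxU⟩ : ∃ x, (U : Set (kernelOrders V Q G)) ⊆ hV.support x ∧
      hV.support x ≤ U := by
    refine U.isClopen.isClosed.isCompact.induction_on
      (p := fun s => ∃ x, s ⊆ hV.support x ∧ hV.support x ≤ U) ?_ ?_ ?_ ?_
    · exact ⟨1, Set.empty_subset _, (hV.support_eq_bot_iff.2 rfl).trans_le bot_le⟩
    · rintro s t hst ⟨x, hx, htx⟩
      exact ⟨x, hst.trans hx, htx⟩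
    · rintro s t ⟨x, hx, hsx⟩ ⟨y, hy, hty⟩
      refine ⟨|x|ₘ ⊔ |y|ₘ, ?_, ?_⟩
      · rw [support_mabs_sup_mabs]
        exact Set.union_subset_union hx hy
      · rw [support_mabs_sup_mabs]
        exact sup_le hsx hty
    · intro C hC
      obtain ⟨x, hx, hxU⟩ := hsep C hC
      exact ⟨_, mem_nhdsWithin_of_mem_nhds ((hV.support x).isClopen.isOpen.mem_nhds hx), x,
        subset_rfl, hxU⟩
  exact ⟨x, le_antisymm hxU hx⟩

theorem isSupportMap : IsSupportMap hV.support where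
  surj := hV.support_surjective
  disjoint_iff x y := by
    rw [disjoint_iff, ← support_mabs_inf_mabs, support_eq_bot_iff]

end IsTame

end Support

/-! ### Orders on the image of `η` -/

section Range

variable {G : Type u} [Group G] [PartialOrder G] {V : LGroupClass.{u}} {Q : Prop}

/-- The right orders on `η[G]` that are normal if `Q` holds. -/
def rangeOrders (V : LGroupClass.{u}) (Q : Prop) (G : Type u) [Group G] [PartialOrder G] :
    Set (PreCone (eta V (G := G)).range) :=
  {E | E ∈ rightOrders (eta V (G := G)).range ∧ (Q → E.IsNormal)}

theorem rangeOrders_eq_rightOrders {V : LGroupClass.{u}} :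
    rightOrders (eta V (G := G)).range = rangeOrders V False G :=
  Set.ext fun _ => ⟨fun h => ⟨h, False.elim⟩, fun h => h.1⟩

theorem rangeOrders_eq_orders {V : LGroupClass.{u}} :
    orders (eta V (G := G)).range = rangeOrders V True G :=
  Set.ext fun _ => ⟨fun h => ⟨h.1, fun _ => h.2⟩, fun h => ⟨h.1, h.2 trivial⟩⟩

theorem mem_of_eta_eq {C : PreCone G} (hC : C ∈ kernelPreorders V Q G) {a b : G}
    (h : eta V a = eta V b) (ha : a ∈ C) : b ∈ C := by
  have := C.mul_mem (hC.1 (b * a⁻¹) (by rw [map_mul, map_inv, h, mul_inv_cancel])) ha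
  simpa using this

/-- A right order on `η[G]` pulls back to a kernel order. -/
def pullback (E : PreCone (eta V (G := G)).range) : PreCone G :=
  PreCone.comap (eta V).rangeRestrict (fun _ _ h => eta_monotone V h) E (by
    obtain ⟨⟨_, a, rfl⟩, h⟩ := E.proper'
    exact ⟨a, h⟩)

theorem mem_pullback {E : PreCone (eta V (G := G)).range} {a : G} :
    a ∈ pullback E ↔ (eta V).rangeRestrict a ∈ E := Iff.rfl

theorem pullback_mem {E : PreCone (eta V (G := G)).range} (hE : E ∈ rangeOrders V Q G) :
    pullback E ∈ kernelOrders V Q G := by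
  have h1 : ∀ a : G, (eta V).rangeRestrict a = 1 ↔ eta V a = 1 := fun a => by
    rw [← Subtype.coe_inj]; rfl
  refine ⟨⟨fun a ha => ?_, fun hQ a ha b => ?_⟩, fun a ha ha' => ?_⟩
  · rw [mem_pullback, (h1 a).2 ha]
    exact E.one_mem
  · rw [mem_pullback, map_mul, map_mul, map_inv]
    exact hE.2 hQ _ ha _
  · rw [mem_pullback, map_inv] at ha'
    exact (h1 a).1 (hE.1 _ ha ha')

variable [MulLeftMono G] [MulRightMono G]

/-- The image of a kernel order under `η`. -/
def IsTame.push (hV : IsTame V Q G) (C : kernelOrders V Q G) :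
    PreCone (eta V (G := G)).range where
  carrier := (eta V).rangeRestrict '' (C.1 : Set G)
  one_mem' := ⟨1, C.1.one_mem, map_one _⟩
  mul_mem' := by
    rintro _ _ ⟨a, ha, rfl⟩ ⟨b, hb, rfl⟩
    exact ⟨a * b, C.1.mul_mem ha hb, map_mul _ _ _⟩
  -- The order inherited from F_V(G) may be larger than the image of that of G, so positivity in G
  -- alone does not suffice.
  pos_mem' := by
    rintro ⟨_, a, rfl⟩ h
    exact ⟨a, C.1.mem_of_one_le_eta (hV.subset C.2.1) h, rfl⟩
  total' := by
    rintro ⟨_, a, rfl⟩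
    rcases C.1.total a with h | h
    · exact Or.inl ⟨a, h, rfl⟩
    · exact Or.inr ⟨a⁻¹, h, map_inv _ _⟩
  proper' := by
    obtain ⟨a, ha⟩ := C.1.proper'
    refine ⟨(eta V).rangeRestrict a, ?_⟩
    rintro ⟨b, hb, hab⟩
    exact ha (mem_of_eta_eq C.2.1 (congrArg Subtype.val hab) hb)

namespace IsTame

variable (hV : IsTame V Q G)

theorem mem_push {C : kernelOrders V Q G} {a : G} :
    (eta V).rangeRestrict a ∈ hV.push C ↔ a ∈ C.1 := by
  constructor
  · rintro ⟨b, hb, hab⟩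
    exact mem_of_eta_eq C.2.1 (congrArg Subtype.val hab) hb
  · exact fun h => ⟨a, h, rfl⟩

theorem push_mem (C : kernelOrders V Q G) : hV.push C ∈ rangeOrders V Q G := by
  constructor
  · rintro ⟨_, a, rfl⟩ h1 h2
    exact Subtype.ext (C.2.2 a (hV.mem_push.1 h1)
      (hV.mem_push.1 (by rw [map_inv]; exact h2)))
  · rintro hQ ⟨_, a, rfl⟩ ha ⟨_, b, rfl⟩
    have := hV.mem_push.2 (C.2.1.2 hQ a (hV.mem_push.1 ha) b)
    rwa [map_mul, map_mul, map_inv] at this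

/-- `C ↦ η[C]` is a homeomorphism from the kernel orders onto the orders of `η[G]`. -/
def pushHomeomorph : kernelOrders V Q G ≃ₜ rangeOrders V Q G where
  toFun C := ⟨hV.push C, hV.push_mem C⟩
  invFun E := ⟨pullback E.1, pullback_mem E.2⟩
  left_inv C := Subtype.ext (PreCone.ext fun a => hV.mem_push)
  right_inv E := Subtype.ext (PreCone.ext fun ⟨y, a, h⟩ => by
    subst h
    exact hV.mem_push (a := a))
  continuous_toFun := by
    refine continuous_induced_rng.2 (continuous_generateFrom_iff.2 ?_)
    rintro _ ⟨⟨_, a, rfl⟩, rfl⟩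
    convert (TopologicalSpace.isOpen_generateFrom_of_mem ⟨a, rfl⟩ :
      IsOpen (PreCone.P a)).preimage continuous_subtype_val using 1
    ext C
    refine and_congr hV.mem_push (not_congr ?_)
    rw [← hV.mem_push, map_inv]
    rfl
  continuous_invFun := by
    refine continuous_induced_rng.2 (continuous_generateFrom_iff.2 ?_)
    rintro _ ⟨a, rfl⟩
    convert (TopologicalSpace.isOpen_generateFrom_of_mem ⟨(eta V).rangeRestrict a, rfl⟩ :
      IsOpen (PreCone.P _)).preimage continuous_subtype_val using 1
    ext E
    refine and_congr Iff.rfl (not_congr ?_)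
    change (eta V).rangeRestrict a⁻¹ ∈ E.1 ↔ _
    rw [map_inv]

include hV

theorem exists_homeomorph {T : Set (PreCone (eta V (G := G)).range)} (hT : T = rangeOrders V Q G) :
    ∃ Φ : minimalLayer V G ≃ₜ T,
      ∀ C, ((Φ C).1 : Set (eta V (G := G)).range) = (eta V).rangeRestrict '' (C.1 : Set G) := by
  subst hT
  exact ⟨(Homeomorph.setCongr hV.minimalLayer_eq).trans hV.pushHomeomorph, fun C => rfl⟩

theorem duality : IsStoneSpace (minimalLayer V G) ∧
    IsBooleanSubalgebraOfPolars (principalPolars (Free V G)) ∧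
    Nonempty (TopologicalSpace.Clopens (minimalLayer V G) ≃o principalPolars (Free V G)) ∧
    Nonempty (minimalLayer V G ≃ₜ StoneDual (principalPolars (Free V G))) := by
  rw [hV.minimalLayer_eq]
  obtain ⟨e⟩ := hV.isSupportMap.nonempty_orderIso
  exact ⟨kernelOrders.isStoneSpace, hV.isSupportMap.isBooleanSubalgebraOfPolars, ⟨e⟩,
    nonempty_homeomorph_stoneDual e⟩

end IsTame

end Range

end LGrp

/-! ### Assembly for the three varieties. -/

theorem theorem6p9 {G : Type u} [Group G] [PartialOrder G] [MulLeftMono G] [MulRightMono G]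
    (V : LGroupClass.{u})
    (hV : V = allLGroups ∨ V = representableLGroups ∨ V = abelianLGroups) :
    IsStoneSpace (minimalLayer V G) ∧
    IsBooleanSubalgebraOfPolars (principalPolars (Free V G)) ∧
    Nonempty (TopologicalSpace.Clopens (minimalLayer V G) ≃o principalPolars (Free V G)) ∧
    Nonempty (minimalLayer V G ≃ₜ StoneDual (principalPolars (Free V G))) ∧
    (V = allLGroups →
      ∃ Φ : minimalLayer V G ≃ₜ rightOrders (eta V (G := G)).range,
        ∀ C, ((Φ C).1 : Set (eta V (G := G)).range) = (eta V).rangeRestrict '' (C.1 : Set G)) ∧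
    (V = representableLGroups ∨ V = abelianLGroups →
      ∃ Φ : minimalLayer V G ≃ₜ orders (eta V (G := G)).range,
        ∀ C, ((Φ C).1 : Set (eta V (G := G)).range) = (eta V).rangeRestrict '' (C.1 : Set G)) := by
  -- The choice of `Q` decides between right orders and orders on η[G].
  have all : V = allLGroups → IsTame V False G := fun h => h ▸ isTame_allLGroups
  have normal : V = representableLGroups ∨ V = abelianLGroups → IsTame V True G := fun h =>
    h.elim (fun h => h ▸ isTame_representableLGroups) (fun h => h ▸ isTame_abelianLGroups)
  obtain ⟨h1, h2, h3, h4⟩ := hV.elim (fun h => (all h).duality) (fun h => (normal h).duality)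
  exact ⟨h1, h2, h3, h4, fun h => (all h).exists_homeomorph rangeOrders_eq_rightOrders,
    fun h => (normal h).exists_homeomorph rangeOrders_eq_orders⟩
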